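/- Let $n\ge 2$. Let $\mathcal S_0(\mathbb R^n)$ be the closed subspace of the Schwartz space $\mathcal S(\mathbb R^n)$ of all complex-valued $\phi$ with $\int_{\mathbb R^n} \mathbf x^m\phi(\mathbf x)\,d\mathbf x=0$ for every multi-index $m\in\mathbb N_0^n$. Let $\mathcal S(\mathbb S^{n-1}\times\mathbb R)$ be the space of all complex-valued $\varrho\in C^\infty(\mathbb S^{n-1}\times\mathbb R)$ such that $$\sup_{(\mathbf u,p)\in\mathbb S^{n-1}\times\mathbb R}(1+p^2)^{r/2}\left|\frac{\partial^m}{\partial p^m}\Delta_{\mathbf u}^k\varrho(\mathbf u,p)\right|<\infty\qquad\text{for all } r,m,k\in\mathbb N_0,$$ with the topology defined by these seminorms, where $\Delta_{\mathbf u}$ is the Laplace–Beltrami operator of the unit sphere $\mathbb S^{n-1}$ of $\mathbb R^n$; and let $\mathcal S_0(\mathbb S^{n-1}\times\mathbb R)$ be its subspace of all $\varrho$ with $\int_{-\infty}^{\infty}p^k\varrho(\mathbf u,p)\,dp=0$ for all $\mathbf u\in\mathbb S^{n-1}$ and $k\in\mathbb N_0$. Let $\mathcal S_0'(\mathbb R^n)$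 (the Lizorkin distributions) and $\mathcal S_0'(\mathbb S^{n-1}\times\mathbb R)$ be the duals of $\mathcal S_0(\mathbb R^n)$ and $\mathcal S_0(\mathbb S^{n-1}\times\mathbb R)$, with the strong dual topologies. The dual Radon transform is $$R^*\varrho(\mathbf x)=\int_{\mathbb S^{n-1}}\varrho(\mathbf u,\mathbf x\cdot\mathbf u)\,d\mathbf u,\qquad \mathbf x\in\mathbb R^n,$$ where $d\mathbf u$ is the surface measure of $\mathbb S^{n-1}$. Then $R^*$ is a well-defined continuous linear map $\mathcal S_0(\mathbb S^{n-1}\times\mathbb R)\to\mathcal S_0(\mathbb R^n)$, so that the Radon transform $Rf\in\mathcal S_0'(\mathbb S^{n-1}\times\mathbb R)$ of $f\in\mathcal S_0'(\mathbb R^n)$ can be defined by transposition, $$\langle Rf,\varrho\rangle=\langle f,R^*\varrho\rangle,\qquad \varrho\in\mathcal S_0(\mathbb S^{n-1}\times\mathbb R),$$ and the linear map $R:\mathcal S_0'(\mathbb R^n)\to\mathcal S_0'(\mathbb S^{n-1}\times\mathbb R)$ is continuous. -/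

import Mathlib

open scoped Manifold ContDiff SchwartzMap

noncomputable section

namespace LizorkinRadon

/-! ## Lizorkin test functions and distributions on `ℝⁿ` -/

/-- `ℝⁿ` with its Euclidean structure. -/
abbrev Euc (n : ℕ) : Type := EuclideanSpace ℝ (Fin n)

/-- The monomial `x ^ m`, for a multi-index `m`. -/
def monomial {n : ℕ} (m : Fin n → ℕ) (x : Euc n) : ℝ := ∏ i, x i ^ m i

theorem monomial_hasTemperateGrowth {n : ℕ} (m : Fin n → ℕ) :
    (monomial (n := n) m).HasTemperateGrowth := by
  have h : ∀ i : Fin n, (fun x : Euc n => x i ^ m i).HasTemperateGrowth := fun i => by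
    have h1 : (fun x : Euc n => x i).HasTemperateGrowth :=
      (EuclideanSpace.proj i : Euc n →L[ℝ] ℝ).hasTemperateGrowth
    induction m i with
    | zero => simp
    | succ k ih => simp only [pow_succ]; exact ih.mul h1
  classical
  have key : ∀ s : Finset (Fin n),
      (fun x : Euc n => ∏ i ∈ s, x i ^ m i).HasTemperateGrowth := fun s => by
    induction s using Finset.induction_on with
    | empty => simp
    | insert a s ha ih => simp only [Finset.prod_insert ha]; exact (h a).mul ih
  exact key Finset.univ

theorem integrable_monomial_smul {n : ℕ} (m : Fin n → ℕ) (φ : 𝓢(Euc n, ℂ)) :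
    MeasureTheory.Integrable (fun x => monomial m x • φ x) := by
  simpa [SchwartzMap.smulLeftCLM_apply (monomial_hasTemperateGrowth m)] using
    (SchwartzMap.smulLeftCLM ℂ (monomial m) φ).integrable

/-- The Lizorkin test function space `𝓢₀(ℝⁿ)`: the Schwartz functions all of whose moments vanish,
with the topology of `𝓢(ℝⁿ)`. -/
def Lizorkin (n : ℕ) : Submodule ℂ 𝓢(Euc n, ℂ) where
  carrier := {φ | ∀ m : Fin n → ℕ, ∫ x, monomial m x • φ x = 0}
  zero_mem' m := by simp
  add_mem' {φ ψ} hφ hψ m := by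
    simp only [add_apply, smul_add]
    rw [MeasureTheory.integral_add (integrable_monomial_smul m φ) (integrable_monomial_smul m ψ),
      hφ m, hψ m, add_zero]
  smul_mem' c φ hφ m := by
    simp only [smul_apply, smul_comm _ c]
    rw [MeasureTheory.integral_smul, hφ m, smul_zero]

/-- The space `𝓢₀'(ℝⁿ)` of Lizorkin distributions. The topology which Mathlib puts on a space of
continuous linear maps is that of uniform convergence on bounded sets: the strong dual topology. -/
abbrev LizorkinDistribution (n : ℕ) : Type := ↥(Lizorkin n) →L[ℂ] ℂ

/-! ## Smooth functions on `𝕊ⁿ⁻¹ × ℝ` and their derivatives -/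

/-- The unit sphere `𝕊ⁿ⁻¹` of `ℝⁿ`. -/
abbrev Sph (n : ℕ) : Type := Metric.sphere (0 : Euc n) 1

instance factFinrank (n : ℕ) [h : Fact (2 ≤ n)] :
    Fact (Module.finrank ℝ (Euc n) = (n - 1) + 1) :=
  ⟨by have := h.out; simp; omega⟩

/-- The model with corners of the manifold `𝕊ⁿ⁻¹ × ℝ`. -/
abbrev cylModel (n : ℕ) := (𝓡 (n - 1)).prod 𝓘(ℝ, ℝ)

/-- The extension of a function on the sphere, constant along rays, `x ↦ f (x / ‖x‖)`
(with the value `0` at the origin, which plays no role). -/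
def rayExt {n : ℕ} (f : Sph n → ℂ) (x : Euc n) : ℂ :=
  if h : x = 0 then 0 else f ⟨‖x‖⁻¹ • x, by simp [norm_smul, h]⟩

/-- The Laplace–Beltrami operator of the unit sphere: the value at `u` of the Euclidean Laplacian
of the extension which is constant along rays. -/
def sphereLaplacian {n : ℕ} (f : Sph n → ℂ) (u : Sph n) : ℂ :=
  Laplacian.laplacian (rayExt f) (u : Euc n)

/-- `Δ_u ϱ (u, p)`. -/
def lapFun {n : ℕ} (ϱ : Sph n × ℝ → ℂ) (z : Sph n × ℝ) : ℂ :=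
  sphereLaplacian (fun u => ϱ (u, z.2)) z.1

/-- `∂ϱ/∂p (u, p)`. -/
def derivFun {n : ℕ} (ϱ : Sph n × ℝ → ℂ) (z : Sph n × ℝ) : ℂ :=
  deriv (fun p => ϱ (z.1, p)) z.2

theorem rayExt_coe {n : ℕ} (f : Sph n → ℂ) (u : Sph n) : rayExt f (u : Euc n) = f u := by
  have hu : ‖(u : Euc n)‖ = 1 := by simp
  have h : (u : Euc n) ≠ 0 := fun h => by simp [h] at hu
  simp only [rayExt, h, dite_false]
  congr 1
  ext1
  simp

section smooth

variable {n : ℕ} [Fact (2 ≤ n)]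

theorem contDiffAt_rayExt {ϱ : Sph n × ℝ → ℂ} (h : ContMDiff (cylModel n) 𝓘(ℝ, ℂ) ∞ ϱ)
    (z : Euc n × ℝ) (hz : z.1 ≠ 0) :
    ContDiffAt ℝ ∞ (fun w : Euc n × ℝ => rayExt (fun u => ϱ (u, w.2)) w.1) z := by
  let M : TopologicalSpace.Opens (Euc n × ℝ) :=
    ⟨{w | w.1 ≠ 0}, isOpen_ne_fun continuous_fst continuous_const⟩
  have hval : ContMDiff 𝓘(ℝ, Euc n × ℝ) 𝓘(ℝ, Euc n × ℝ) ∞ (Subtype.val : M → Euc n × ℝ) :=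
    contMDiff_subtype_val
  have hdir : ContMDiff 𝓘(ℝ, Euc n × ℝ) 𝓘(ℝ, Euc n) ∞
      (fun w : M => ‖w.1.1‖⁻¹ • w.1.1) := by
    intro w
    have h1 : ContDiffAt ℝ ∞ (fun w : Euc n × ℝ => ‖w.1‖⁻¹ • w.1) w.1 := by
      have hw : w.1.1 ≠ 0 := w.2
      exact ((contDiffAt_fst.norm ℝ hw).inv (by simpa using hw)).smul contDiffAt_fst
    exact h1.contMDiffAt.comp w hval.contMDiffAt
  have hsph := hdir.codRestrict_sphere (n := n - 1) (fun w => by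
    have hw : w.1.1 ≠ 0 := w.2
    simp [norm_smul, hw])
  have hsnd : ContMDiff 𝓘(ℝ, Euc n × ℝ) 𝓘(ℝ, ℝ) ∞ (fun w : M => w.1.2) :=
    (contDiff_snd.contMDiff (n := ∞)).comp hval
  have hcomp := h.comp (hsph.prodMk hsnd)
  have hG : ContMDiffAt 𝓘(ℝ, Euc n × ℝ) 𝓘(ℝ, ℂ) ∞
      (fun w : Euc n × ℝ => rayExt (fun u => ϱ (u, w.2)) w.1) ((⟨z, hz⟩ : M) : Euc n × ℝ) := by
    rw [← contMDiffAt_subtype_iff]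
    convert hcomp.contMDiffAt using 1
    ext w
    have hw : w.1.1 ≠ 0 := w.2
    simp only [rayExt, hw, dite_false]
    rfl
  exact hG.contDiffAt

theorem contMDiff_of_ext {G : Euc n × ℝ → ℂ}
    (hG : ∀ z : Euc n × ℝ, z.1 ≠ 0 → ContDiffAt ℝ ∞ G z) :
    ContMDiff (cylModel n) 𝓘(ℝ, ℂ) ∞ (fun z : Sph n × ℝ => G (z.1, z.2)) := by
  intro z
  have hu : ‖(z.1 : Euc n)‖ = 1 := by simp
  have h0 : (z.1 : Euc n) ≠ 0 := fun h => by simp [h] at hu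
  have h1 : ContMDiff (cylModel n) 𝓘(ℝ, Euc n) ∞ (fun z : Sph n × ℝ => (z.1 : Euc n)) :=
    contMDiff_coe_sphere.comp contMDiff_fst
  have h2 : ContMDiff (cylModel n) 𝓘(ℝ, ℝ) ∞ (fun z : Sph n × ℝ => z.2) := contMDiff_snd
  exact (hG (z.1, z.2) h0).contMDiffAt.comp z (h1.prodMk_space h2).contMDiffAt

theorem contDiffAt_slice {ϱ : Sph n × ℝ → ℂ} (h : ContMDiff (cylModel n) 𝓘(ℝ, ℂ) ∞ ϱ)
    (z : Sph n × ℝ) : ContDiffAt ℝ ∞ (rayExt fun u => ϱ (u, z.2)) (z.1 : Euc n) := by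
  have hu : ‖(z.1 : Euc n)‖ = 1 := by simp
  have h0 : (z.1 : Euc n) ≠ 0 := fun h => by simp [h] at hu
  exact (contDiffAt_rayExt h (z.1, z.2) h0).comp (z.1 : Euc n)
    (contDiffAt_id.prodMk contDiffAt_const)

theorem differentiableAt_slice {ϱ : Sph n × ℝ → ℂ} (h : ContMDiff (cylModel n) 𝓘(ℝ, ℂ) ∞ ϱ)
    (z : Sph n × ℝ) : DifferentiableAt ℝ (fun p => ϱ (z.1, p)) z.2 := by
  have h1 : ContMDiff 𝓘(ℝ, ℝ) 𝓘(ℝ, ℂ) ∞ (fun p => ϱ (z.1, p)) :=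
    h.comp (contMDiff_const.prodMk contMDiff_id)
  exact (h1.contDiff.differentiable (by simp)) z.2

theorem contMDiff_lapFun {ϱ : Sph n × ℝ → ℂ} (h : ContMDiff (cylModel n) 𝓘(ℝ, ℂ) ∞ ϱ) :
    ContMDiff (cylModel n) 𝓘(ℝ, ℂ) ∞ (lapFun ϱ) := by
  refine contMDiff_of_ext
    (G := fun w => Laplacian.laplacian (rayExt fun u => ϱ (u, w.2)) w.1) fun z hz => ?_
  have hev : ∀ w : Euc n × ℝ, w.1 ≠ 0 → ContDiffAt ℝ ∞
      (fun w : Euc n × ℝ => fderiv ℝ (rayExt fun u => ϱ (u, w.2)) w.1) w := fun w hw =>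
    ContDiffAt.fderiv (n := ∞) (f := fun (w : Euc n × ℝ) x => rayExt (fun u => ϱ (u, w.2)) x)
      ((contDiffAt_rayExt h w hw).comp (w, w.1)
        (contDiffAt_snd.prodMk (contDiffAt_snd.comp _ contDiffAt_fst)))
      contDiffAt_fst (by simp)
  have hev2 : ContDiffAt ℝ ∞
      (fun w : Euc n × ℝ => fderiv ℝ (fderiv ℝ (rayExt fun u => ϱ (u, w.2))) w.1) z :=
    ContDiffAt.fderiv (n := ∞)
      (f := fun (w : Euc n × ℝ) x => fderiv ℝ (rayExt fun u => ϱ (u, w.2)) x)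
      (ContDiffAt.comp (g := fun w : Euc n × ℝ => fderiv ℝ (rayExt fun u => ϱ (u, w.2)) w.1)
        (f := fun y : (Euc n × ℝ) × Euc n => (y.2, y.1.2)) (z, z.1) (hev z hz)
        (contDiffAt_snd.prodMk (contDiffAt_snd.comp _ contDiffAt_fst)))
      contDiffAt_fst (by simp)
  simp only [InnerProductSpace.laplacian_eq_iteratedFDeriv_stdOrthonormalBasis,
    iteratedFDeriv_two_apply]
  refine ContDiffAt.sum fun i _ => ?_
  exact (hev2.clm_apply contDiffAt_const).clm_apply contDiffAt_const

theorem contMDiff_derivFun {ϱ : Sph n × ℝ → ℂ} (h : ContMDiff (cylModel n) 𝓘(ℝ, ℂ) ∞ ϱ) :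
    ContMDiff (cylModel n) 𝓘(ℝ, ℂ) ∞ (derivFun ϱ) := by
  have := contMDiff_of_ext
    (G := fun w : Euc n × ℝ => deriv (fun p => rayExt (fun u => ϱ (u, p)) w.1) w.2) fun z hz => by
      have h1 : ContDiffAt ℝ ∞ (fun w : Euc n × ℝ =>
          fderiv ℝ (fun p => rayExt (fun u => ϱ (u, p)) w.1) w.2) z :=
        ContDiffAt.fderiv (n := ∞)
          (f := fun (w : Euc n × ℝ) p => rayExt (fun u => ϱ (u, p)) w.1)
          ((contDiffAt_rayExt h z hz).comp (z, z.2)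
            ((contDiffAt_fst.comp _ contDiffAt_fst).prodMk contDiffAt_snd))
          contDiffAt_snd (by simp)
      exact h1.clm_apply contDiffAt_const
  simp only [rayExt_coe] at this
  exact this

theorem lapFun_add {ϱ σ : Sph n × ℝ → ℂ} (h : ContMDiff (cylModel n) 𝓘(ℝ, ℂ) ∞ ϱ)
    (h' : ContMDiff (cylModel n) 𝓘(ℝ, ℂ) ∞ σ) : lapFun (ϱ + σ) = lapFun ϱ + lapFun σ := by
  funext z
  have e : (rayExt fun u => (ϱ + σ) (u, z.2)) =
      (rayExt fun u => ϱ (u, z.2)) + rayExt fun u => σ (u, z.2) := by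
    funext x
    by_cases hx : x = 0 <;> simp [rayExt, hx]
  change Laplacian.laplacian (rayExt fun u => (ϱ + σ) (u, z.2)) (z.1 : Euc n) = _
  rw [e]
  exact ((contDiffAt_slice h z).of_le (WithTop.coe_le_coe.2 le_top)).laplacian_add
    ((contDiffAt_slice h' z).of_le (WithTop.coe_le_coe.2 le_top))

theorem lapFun_smul (c : ℂ) {ϱ : Sph n × ℝ → ℂ} (h : ContMDiff (cylModel n) 𝓘(ℝ, ℂ) ∞ ϱ) :
    lapFun (c • ϱ) = c • lapFun ϱ := by
  funext z
  have e : (rayExt fun u => (c • ϱ) (u, z.2)) = c • (rayExt fun u => ϱ (u, z.2)) := by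
    funext x
    by_cases hx : x = 0 <;> simp [rayExt, hx]
  change Laplacian.laplacian (rayExt fun u => (c • ϱ) (u, z.2)) (z.1 : Euc n) = _
  rw [e]
  exact InnerProductSpace.laplacian_smul c
    ((contDiffAt_slice h z).of_le (WithTop.coe_le_coe.2 le_top))

theorem derivFun_add {ϱ σ : Sph n × ℝ → ℂ} (h : ContMDiff (cylModel n) 𝓘(ℝ, ℂ) ∞ ϱ)
    (h' : ContMDiff (cylModel n) 𝓘(ℝ, ℂ) ∞ σ) :
    derivFun (ϱ + σ) = derivFun ϱ + derivFun σ := by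
  funext z
  exact deriv_add (differentiableAt_slice h z) (differentiableAt_slice h' z)

theorem derivFun_smul (c : ℂ) {ϱ : Sph n × ℝ → ℂ} (h : ContMDiff (cylModel n) 𝓘(ℝ, ℂ) ∞ ϱ) :
    derivFun (c • ϱ) = c • derivFun ϱ := by
  funext z
  exact deriv_const_smul c (differentiableAt_slice h z)

end smooth

variable (n : ℕ) [Fact (2 ≤ n)]

/-- `C^∞(𝕊ⁿ⁻¹ × ℝ)`, the complex-valued smooth functions on the manifold `𝕊ⁿ⁻¹ × ℝ`. -/
def Smooth : Submodule ℂ (Sph n × ℝ → ℂ) where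
  carrier := {ϱ | ContMDiff (cylModel n) 𝓘(ℝ, ℂ) ∞ ϱ}
  zero_mem' := contMDiff_const
  add_mem' {_ _} h h' := ContMDiff.add h h'
  smul_mem' c ϱ h := by
    have hc : ContMDiff 𝓘(ℝ, ℂ) 𝓘(ℝ, ℂ) ∞ (fun w : ℂ => c • w) :=
      (contDiff_const_smul c).contMDiff
    exact hc.comp h

/-- The Laplace–Beltrami operator `Δ_u` in the spherical variable. -/
def lapU : Smooth n →ₗ[ℂ] Smooth n where
  toFun ϱ := ⟨lapFun ϱ.1, contMDiff_lapFun ϱ.2⟩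
  map_add' ϱ σ := Subtype.ext (lapFun_add ϱ.2 σ.2)
  map_smul' c ϱ := Subtype.ext (lapFun_smul c ϱ.2)

/-- The derivative `∂/∂p` in the real variable. -/
def derivP : Smooth n →ₗ[ℂ] Smooth n where
  toFun ϱ := ⟨derivFun ϱ.1, contMDiff_derivFun ϱ.2⟩
  map_add' ϱ σ := Subtype.ext (derivFun_add ϱ.2 σ.2)
  map_smul' c ϱ := Subtype.ext (derivFun_smul c ϱ.2)

/-- `(1 + p²)^(r/2) ∂ₚᵐ Δᵤᵏ ϱ (u, p)`. -/
def weighted (r m k : ℕ) (z : Sph n × ℝ) : Smooth n →ₗ[ℂ] ℂ where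
  toFun ϱ := (((1 + z.2 ^ 2) ^ ((r : ℝ) / 2) : ℝ) : ℂ) *
    ((derivP n ^ m) ((lapU n ^ k) ϱ) : Sph n × ℝ → ℂ) z
  map_add' ϱ σ := by simp [mul_add]
  map_smul' c ϱ := by simp; ring

/-! ## The spaces `𝓢(𝕊ⁿ⁻¹ × ℝ)` and `𝓢₀(𝕊ⁿ⁻¹ × ℝ)` -/

/-- The smooth `ϱ` with `sup_{u,p} (1 + p²)^(r/2) |∂ₚᵐ Δᵤᵏ ϱ (u, p)| < ∞` for all `r, m, k`. -/
def schwartzSubmodule : Submodule ℂ (Smooth n) where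
  carrier := {ϱ | ∀ r m k : ℕ, BddAbove (Set.range fun z => ‖weighted n r m k z ϱ‖)}
  zero_mem' r m k := ⟨0, by rintro _ ⟨z, rfl⟩; simp⟩
  add_mem' {ϱ σ} h h' r m k := by
    obtain ⟨A, hA⟩ := h r m k
    obtain ⟨B, hB⟩ := h' r m k
    refine ⟨A + B, ?_⟩
    rintro _ ⟨z, rfl⟩
    simp only [map_add]
    exact (norm_add_le _ _).trans (add_le_add (hA ⟨z, rfl⟩) (hB ⟨z, rfl⟩))
  smul_mem' c ϱ h r m k := by
    obtain ⟨A, hA⟩ := h r m k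
    refine ⟨‖c‖ * A, ?_⟩
    rintro _ ⟨z, rfl⟩
    simp only [map_smul, norm_smul]
    exact mul_le_mul_of_nonneg_left (hA ⟨z, rfl⟩) (norm_nonneg c)

/-- The Schwartz space `𝓢(𝕊ⁿ⁻¹ × ℝ)`. It is a type of its own since it does not carry the topology
of pointwise convergence. -/
def SphereSchwartz : Type := ↥(schwartzSubmodule n)

namespace SphereSchwartz

instance : AddCommGroup (SphereSchwartz n) := inferInstanceAs (AddCommGroup ↥(schwartzSubmodule n))

instance : Module ℂ (SphereSchwartz n) := inferInstanceAs (Module ℂ ↥(schwartzSubmodule n))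

instance : CoeFun (SphereSchwartz n) (fun _ => Sph n × ℝ → ℂ) := ⟨fun ϱ => ϱ.1.1⟩

variable {n} in
@[simp] theorem add_apply (ϱ σ : SphereSchwartz n) (z : Sph n × ℝ) : (ϱ + σ) z = ϱ z + σ z := rfl

variable {n} in
@[simp] theorem smul_apply (c : ℂ) (ϱ : SphereSchwartz n) (z : Sph n × ℝ) :
    (c • ϱ) z = c * ϱ z := rfl

@[simp] theorem zero_apply (z : Sph n × ℝ) : (0 : SphereSchwartz n) z = 0 := rfl

/-- The seminorms `sup_{u,p} (1 + p²)^(r/2) |∂ₚᵐ Δᵤᵏ ϱ (u, p)|`, indexed by `(r, m, k)`. -/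
def seminormFamily : SeminormFamily ℂ (SphereSchwartz n) (ℕ × ℕ × ℕ) := fun i =>
  Seminorm.of (fun ϱ => ⨆ z, ‖weighted n i.1 i.2.1 i.2.2 z ϱ.1‖)
    (fun ϱ σ => by
      have : Nonempty (Sph n × ℝ) := by
        have hn : 2 ≤ n := Fact.out
        exact ⟨⟨⟨EuclideanSpace.single ⟨0, by omega⟩ 1, by simp⟩, 0⟩⟩
      refine ciSup_le fun z => ?_
      have e : weighted n i.1 i.2.1 i.2.2 z (ϱ + σ).1 = weighted n i.1 i.2.1 i.2.2 z ϱ.1 +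
        weighted n i.1 i.2.1 i.2.2 z σ.1 := map_add (weighted n i.1 i.2.1 i.2.2 z) ϱ.1 σ.1
      rw [e]
      exact (norm_add_le _ _).trans
        (add_le_add (le_ciSup (ϱ.2 i.1 i.2.1 i.2.2) z) (le_ciSup (σ.2 i.1 i.2.1 i.2.2) z)))
    (fun c ϱ => by
      rw [Real.mul_iSup_of_nonneg (norm_nonneg c)]
      refine congrArg _ (funext fun z => ?_)
      have e : weighted n i.1 i.2.1 i.2.2 z (c • ϱ).1 = c • weighted n i.1 i.2.1 i.2.2 z ϱ.1 :=
        map_smul (weighted n i.1 i.2.1 i.2.2 z) c ϱ.1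
      rw [e, norm_smul])

instance : TopologicalSpace (SphereSchwartz n) := (seminormFamily n).moduleFilterBasis.topology'

theorem withSeminorms : WithSeminorms (seminormFamily n) := ⟨rfl⟩

instance : IsTopologicalAddGroup (SphereSchwartz n) :=
  (withSeminorms n).topologicalAddGroup

instance : ContinuousSMul ℂ (SphereSchwartz n) :=
  (withSeminorms n).continuousSMul

variable {n} in
theorem continuous_slice (ϱ : SphereSchwartz n) (u : Sph n) : Continuous fun p : ℝ => ϱ (u, p) :=
  ϱ.1.2.continuous.comp (by fun_prop)

variable {n} in
theorem integrable_moment (ϱ : SphereSchwartz n) (u : Sph n) (k : ℕ) :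
    MeasureTheory.Integrable fun p : ℝ => ((p ^ k : ℝ) : ℂ) * ϱ (u, p) := by
  obtain ⟨C, hC⟩ := ϱ.2 (k + 2) 0 0
  have hcont := continuous_slice ϱ u
  refine (integrable_inv_one_add_sq.const_mul C).mono'
    (by fun_prop) (Filter.Eventually.of_forall fun p => ?_)
  have h1 := hC ⟨(u, p), rfl⟩
  have hpos : (0 : ℝ) < 1 + p ^ 2 := by positivity
  simp only [weighted, LinearMap.coe_mk, AddHom.coe_mk, pow_zero, Module.End.one_apply, norm_mul,
    Complex.norm_real] at h1
  rw [Real.norm_of_nonneg (by positivity)] at h1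
  have h2 : |p| ^ k ≤ (1 + p ^ 2) ^ ((k : ℝ) / 2) := by
    rw [← Real.sqrt_sq_eq_abs, Real.sqrt_eq_rpow, ← Real.rpow_natCast,
      ← Real.rpow_mul (by positivity),
      show 1 / 2 * (k : ℝ) = (k : ℝ) / 2 by ring]
    exact Real.rpow_le_rpow (by positivity) (by linarith) (by positivity)
  have h3 : (1 + p ^ 2) ^ (((k + 2 : ℕ) : ℝ) / 2) = (1 + p ^ 2) ^ ((k : ℝ) / 2) * (1 + p ^ 2) := by
    rw [show ((k + 2 : ℕ) : ℝ) / 2 = (k : ℝ) / 2 + 1 by push_cast; ring, Real.rpow_add hpos,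
      Real.rpow_one]
  rw [h3] at h1
  rw [norm_mul, Complex.norm_real, norm_pow, Real.norm_eq_abs, ← div_eq_mul_inv, le_div_iff₀ hpos]
  calc |p| ^ k * ‖ϱ (u, p)‖ * (1 + p ^ 2)
      ≤ (1 + p ^ 2) ^ ((k : ℝ) / 2) * ‖ϱ (u, p)‖ * (1 + p ^ 2) := by gcongr
    _ = (1 + p ^ 2) ^ ((k : ℝ) / 2) * (1 + p ^ 2) * ‖ϱ (u, p)‖ := by ring
    _ ≤ C := h1

end SphereSchwartz

/-- The space `𝓢₀(𝕊ⁿ⁻¹ × ℝ)`: all the moments in the variable `p` vanish, for every `u`. It carries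
the topology of `𝓢(𝕊ⁿ⁻¹ × ℝ)`. -/
def SphereLizorkin : Submodule ℂ (SphereSchwartz n) where
  carrier := {ϱ | ∀ (u : Sph n) (k : ℕ), ∫ p : ℝ, ((p ^ k : ℝ) : ℂ) * ϱ (u, p) = 0}
  zero_mem' u k := by simp
  add_mem' {ϱ σ} h h' u k := by
    simp only [SphereSchwartz.add_apply, mul_add]
    rw [MeasureTheory.integral_add (ϱ.integrable_moment u k) (σ.integrable_moment u k), h u k,
      h' u k, add_zero]
  smul_mem' c ϱ h u k := by
    simp only [SphereSchwartz.smul_apply, mul_left_comm _ c]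
    rw [MeasureTheory.integral_const_mul, h u k, mul_zero]

/-- The space `𝓢₀'(𝕊ⁿ⁻¹ × ℝ)`, with the strong dual topology. -/
abbrev SphereLizorkinDistribution : Type := ↥(SphereLizorkin n) →L[ℂ] ℂ

/-! ## The dual Radon transform -/

variable {n} in
/-- The dual Radon transform `R* ϱ (x) = ∫_{𝕊ⁿ⁻¹} ϱ (u, x · u) du`, where `du` is the surface
measure of the sphere. -/
def dualRadon (ϱ : Sph n × ℝ → ℂ) (x : Euc n) : ℂ :=
  ∫ u : Sph n, ϱ (u, inner ℝ x (u : Euc n))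
    ∂(MeasureTheory.volume : MeasureTheory.Measure (Euc n)).toSphere

end LizorkinRadon

end

open scoped Manifold ContDiff SchwartzMap

noncomputable section

namespace LizorkinRadon

open MeasureTheory Set Filter Topology

/-! The main difficulty is the rapid decay of `R* ϱ`, with bounds by seminorms that only see `∂ₚ`
and powers of `Δᵤ`. The engine is an identity on the sphere, `integral_laplacian_hyperplane`: if `P
(u, s)` is homogeneous of degree `0` in `u`, then the integral over `u` of `Δᵤ P - (‖x‖² - s²) ∂ₛ² P
+ (n - 1) s ∂ₛ P`, taken at `s = ⟪x, u⟫`, vanishes. It comes from the divergence theorem applied to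
two vector fields whose mixed second derivatives cancel.

Primitives in `p` are taken from `-∞`. Since all moments of `ϱ` vanish, every iterated primitive
again decays rapidly and has vanishing moments. The same holds for `Δᵤᵏ ϱ`, because the symmetry of
`Δᵤ` makes it preserve the vanishing of moments (`momentFree_lapFun`). For a polynomial `η`, the
identity for `η (s)` times the second primitive of `f` expresses `‖x‖² ∫ η f` through integrals of
the same kind without `‖x‖²`, involving primitives of `f` and of `Δᵤ f`, and two terms that keep
`‖x‖²` but have `η'` and `η''` in place of `η`. A double induction, on the power of `‖x‖²` and on
the degree of `η`, gives the decay (`dominated_pow_mul_weightedDual`).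

Derivatives of `R* ϱ` are bounded by differentiation under the integral sign, and a Landau
inequality between orders `m` and `m + 2` turns boundedness plus decay of the function into decay of
all derivatives (`dominated_iteratedFDeriv`).

For the moments, `‖u‖ = 1` implies that the Euclidean Laplacian of `R*` of the `(m + 2)`-fold
primitive is `R*` of the `m`-fold one. Integrating by parts against a monomial lowers its degree by
two, and induction on the degree, over all primitives at once, finishes. Finally, the transpose of a
continuous linear map is continuous for the strong dual topologies. -/

/-! ### Polar coordinates and the divergence theorem on the sphere -/

/-- The surface measure of the sphere. -/
abbrev surf (n : ℕ) : Measure (Sph n) := (volume : Measure (Euc n)).toSphere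

/-- Integration in polar coordinates of a function which separates. -/
theorem integral_polar {n : ℕ} {f : Euc n → ℂ} {a : Sph n → ℂ} {b : ℝ → ℝ}
    (h : ∀ (u : Sph n) (r : ℝ), 0 < r → f (r • (u : Euc n)) = a u * b r) [Fact (2 ≤ n)] :
    ∫ y, f y = (∫ u, a u ∂(surf n)) * ((∫ r in Ioi (0 : ℝ), r ^ (n - 1) * b r : ℝ) : ℂ) := by
  have hn : 2 ≤ n := Fact.out
  have : Nontrivial (Euc n) := Module.nontrivial_of_finrank_pos (R := ℝ) (by simp; omega)
  calc ∫ y, f y = ∫ y : ({(0)}ᶜ : Set (Euc n)), f y.1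
          ∂((volume : Measure (Euc n)).comap Subtype.val) := by
        rw [integral_subtype_comap (measurableSet_singleton _).compl f,
          restrict_compl_singleton]
    _ = ∫ z : Sph n × Ioi (0 : ℝ), a z.1 * (b z.2 : ℂ)
          ∂(surf n).prod (.volumeIoiPow (Module.finrank ℝ (Euc n) - 1)) := by
        rw [← (volume : Measure (Euc n)).measurePreserving_homeomorphUnitSphereProd.integral_comp
          (Homeomorph.measurableEmbedding _)]
        refine integral_congr_ae (Eventually.of_forall fun y => ?_)
        have hy : ‖(y : Euc n)‖ ≠ 0 := norm_ne_zero_iff.2 y.2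
        simp only
        rw [← h _ _ (homeomorphUnitSphereProd (Euc n) y).2.2]
        congr 1
        simp [smul_smul, hy]
    _ = (∫ u, a u ∂(surf n)) *
          ∫ r : Ioi (0 : ℝ), (b r : ℂ) ∂(.volumeIoiPow (Module.finrank ℝ (Euc n) - 1)) :=
        integral_prod_mul a (fun r : Ioi (0 : ℝ) => (b r : ℂ))
    _ = _ := by
        rw [integral_complex_ofReal]
        congr 2
        simp only [Measure.volumeIoiPow, ENNReal.ofReal]
        rw [integral_withDensity_eq_integral_smul,
          integral_subtype_comap measurableSet_Ioi
            fun r ↦ Real.toNNReal (r ^ (Module.finrank ℝ (Euc n) - 1)) • b r,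
          setIntegral_congr_fun measurableSet_Ioi fun x hx ↦ ?_]
        · rw [NNReal.smul_def, Real.coe_toNNReal _ (pow_nonneg hx.out.le _)]
          simp
        · exact (measurable_subtype_coe.pow_const _).real_toNNReal

theorem contDiff_annular {n : ℕ} {k : ℕ∞} {χ : ℝ → ℝ} (hχ : ContDiff ℝ k χ)
    (h0 : ∀ r < 1, χ r = 0) {G : Euc n → ℂ} (hG : ∀ y ≠ 0, ContDiffAt ℝ k G y) :
    ContDiff ℝ k fun y => χ ‖y‖ • G y := by
  rw [contDiff_iff_contDiffAt]
  intro y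
  by_cases hy : y = 0
  · subst hy
    have : (fun y => χ ‖y‖ • G y) =ᶠ[𝓝 0] fun _ => 0 := by
      filter_upwards [Metric.ball_mem_nhds (0 : Euc n) one_pos] with y hy
      rw [h0 _ (by simpa using hy), zero_smul]
    exact contDiffAt_const.congr_of_eventuallyEq this
  · exact (hχ.contDiffAt.comp y (contDiffAt_id.norm ℝ hy)).smul (hG y hy)

theorem hasCompactSupport_annular {n : ℕ} {χ : ℝ → ℝ} (h3 : ∀ r, 3 < r → χ r = 0)
    (G : Euc n → ℂ) : HasCompactSupport fun y => χ ‖y‖ • G y := by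
  refine HasCompactSupport.intro (isCompact_closedBall (0 : Euc n) 3) fun y hy => ?_
  rw [h3 _ (by simpa using hy), zero_smul]

/-- Vanishing below radius `1` hides the singularity at the origin of functions that are constant
along rays. The value `1` at radius `2` makes the radial integral that is divided out later nonzero.
-/
theorem exists_radial_cutoff : ∃ χ : ℝ → ℝ, ContDiff ℝ ∞ χ ∧ (∀ r, 0 ≤ χ r) ∧ χ 2 = 1 ∧
    (∀ r < 1, χ r = 0) ∧ (∀ r, 3 < r → χ r = 0) := by
  let φ : ContDiffBump (2 : ℝ) := ⟨1 / 2, 1, by norm_num, by norm_num⟩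
  refine ⟨φ, φ.contDiff, fun r => φ.nonneg, φ.one_of_mem_closedBall (by simp [φ]),
    fun r hr => φ.zero_of_le_dist ?_, fun r hr => φ.zero_of_le_dist ?_⟩ <;>
  · simp only [φ, Real.dist_eq, le_abs]
    first
    | (left; linarith)
    | (right; linarith)

/-- Integration by parts in the radius. The factor `n - 1` produced here becomes the curvature term
of the divergence theorem on the sphere. -/
theorem integral_radial_deriv {n : ℕ} (hn : 2 ≤ n) {χ : ℝ → ℝ} (hχ : ContDiff ℝ ∞ χ)
    (h1 : ∀ r < 1, χ r = 0) (h3 : ∀ r, 3 < r → χ r = 0) :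
    ∫ r in Ioi (0 : ℝ), r ^ (n - 1) * deriv χ r =
      -((n - 1 : ℝ) * ∫ r in Ioi (0 : ℝ), r ^ (n - 1) * (r⁻¹ * χ r)) := by
  have hcs : HasCompactSupport χ :=
    HasCompactSupport.intro (isCompact_Icc (a := (1 : ℝ)) (b := 3)) fun r hr => by
      simp only [mem_Icc, not_and_or, not_le] at hr
      exact hr.elim (h1 r) (h3 r)
  have hd : Continuous (deriv χ) := hχ.continuous_deriv (by simp)
  have hd1 : ∀ r < 1, deriv χ r = 0 := fun r hr => by
    have : χ =ᶠ[𝓝 r] fun _ => 0 := by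
      filter_upwards [Iio_mem_nhds hr] with s hs using h1 s hs
    rw [this.deriv_eq]; simp
  have e1 : ∫ r in Ioi (0 : ℝ), r ^ (n - 1) * deriv χ r = ∫ r, r ^ (n - 1) * deriv χ r :=
    setIntegral_eq_integral_of_forall_compl_eq_zero fun r hr => by
      rw [hd1 r (lt_of_le_of_lt (not_lt.1 hr) one_pos), mul_zero]
  have e2 : ∫ r in Ioi (0 : ℝ), r ^ (n - 1) * (r⁻¹ * χ r) =
      ∫ r, r ^ (n - 1 - 1) * χ r := by
    have e3 : ∫ r in Ioi (0 : ℝ), r ^ (n - 1 - 1) * χ r = ∫ r, r ^ (n - 1 - 1) * χ r :=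
      setIntegral_eq_integral_of_forall_compl_eq_zero fun r hr => by
        rw [h1 r (lt_of_le_of_lt (not_lt.1 hr) one_pos), mul_zero]
    rw [← e3]
    refine setIntegral_congr_fun measurableSet_Ioi fun r hr => ?_
    have hr' : r ≠ 0 := ne_of_gt hr
    -- With `n = m + 2` the exponent `n - 1 - 1` is an honest natural number, not a truncated one.
    obtain ⟨m, rfl⟩ : ∃ m, n = m + 2 := ⟨n - 2, by omega⟩
    simp only [Nat.add_one_sub_one, pow_succ]
    field_simp
  rw [e1, e2, integral_mul_deriv_eq_deriv_mul_of_integrable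
    (u' := fun r => ((n - 1 : ℕ) : ℝ) * r ^ (n - 1 - 1)) (fun r _ => hasDerivAt_pow _ _)
    (fun r _ => (hχ.differentiable (by simp) r).hasDerivAt)]
  · rw [← integral_const_mul]
    congr 2
    funext r
    rw [Nat.cast_sub (by omega)]
    push_cast
    ring
  · exact (Continuous.integrable_of_hasCompactSupport (by fun_prop) hcs.deriv.mul_left)
  · exact (Continuous.integrable_of_hasCompactSupport (by have := hχ.continuous; fun_prop)
      hcs.mul_left)
  · exact (Continuous.integrable_of_hasCompactSupport (by have := hχ.continuous; fun_prop)
      hcs.mul_left)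

theorem contDiffAt_direction {n : ℕ} {y : Euc n} (hy : y ≠ 0) :
    ContDiffAt ℝ ∞ (fun y : Euc n => ‖y‖⁻¹ • y) y :=
  ((contDiffAt_id.norm ℝ hy).inv (norm_ne_zero_iff.2 hy)).smul contDiffAt_id

theorem hasFDerivAt_norm_ray {n : ℕ} (u : Sph n) {r : ℝ} (hr : 0 < r) :
    HasFDerivAt (fun y : Euc n => ‖y‖) (innerSL ℝ (u : Euc n)) (r • (u : Euc n)) := by
  have hu : ‖(u : Euc n)‖ = 1 := by simp
  have h0 : r • (u : Euc n) ≠ 0 := by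
    rw [← norm_ne_zero_iff, norm_smul, hu]; simp [hr.ne']
  have h1 := (hasStrictFDerivAt_norm_sq (r • (u : Euc n))).hasFDerivAt.sqrt (by simpa using h0)
  simp only [Real.sqrt_sq (norm_nonneg _)] at h1
  have e : innerSL ℝ (u : Euc n) =
      (1 / (2 * ‖r • (u : Euc n)‖)) • 2 • innerSL ℝ (r • (u : Euc n)) := by
    ext v
    simp [norm_smul, hu, abs_of_pos hr]
    field_simp
  rw [e]
  exact h1

/-- At distance `r` the radial projection contracts tangent vectors by `r⁻¹` and kills the radial
direction. -/
theorem hasFDerivAt_direction_ray {n : ℕ} (u : Sph n) {r : ℝ} (hr : 0 < r) (v : Euc n) :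
    fderiv ℝ (fun y : Euc n => ‖y‖⁻¹ • y) (r • (u : Euc n)) v =
      r⁻¹ • (v - inner ℝ (u : Euc n) v • (u : Euc n)) := by
  have hu : ‖(u : Euc n)‖ = 1 := by simp
  have hr' : ‖r • (u : Euc n)‖ = r := by rw [norm_smul, hu]; simp [abs_of_pos hr]
  have h1 := (hasFDerivAt_norm_ray u hr)
  have h2 := ((hasDerivAt_inv (by rw [hr']; exact hr.ne')).comp_hasFDerivAt _ h1).smul
    (hasFDerivAt_id (r • (u : Euc n)))
  have h3 : fderiv ℝ (fun y : Euc n => ‖y‖⁻¹ • y) (r • (u : Euc n)) = _ := h2.fderiv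
  rw [h3]
  simp [hr', smul_smul, smul_sub]
  rw [← sub_eq_add_neg]
  congr 2
  field_simp

/-- The divergence theorem on the sphere, in a fixed direction `v`. -/
theorem integral_sphere_fderiv {n : ℕ} [Fact (2 ≤ n)] {H : Euc n → ℂ}
    (hH : ∀ y ≠ 0, ContDiffAt ℝ 1 H y) (v : Euc n) :
    ∫ u : Sph n, (fderiv ℝ H u v - inner ℝ (u : Euc n) v • fderiv ℝ H u u
      - ((n - 1 : ℝ) * inner ℝ (u : Euc n) v) • H u) ∂(surf n) = 0 := by
  have hn : 2 ≤ n := Fact.out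
  obtain ⟨χ, hχ, hpos, h2, h1, h3⟩ := exists_radial_cutoff
  set N : Euc n → Euc n := fun y => ‖y‖⁻¹ • y with hN
  have hNne : ∀ y : Euc n, y ≠ 0 → N y ≠ 0 := fun y hy => by simp [hN, hy]
  have hHN : ∀ y ≠ 0, ContDiffAt ℝ 1 (fun y => H (N y)) y := fun y hy =>
    (hH _ (hNne y hy)).comp y ((contDiffAt_direction hy).of_le (by simp))
  -- Extending `H` from the sphere along rays and cutting off to an annulus gives a compactly
  -- supported `C¹` function, so the integral of its derivative along `v` vanishes. Polar
  -- coordinates then turn this into a statement on the sphere.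
  set h : Euc n → ℂ := fun y => χ ‖y‖ • H (N y) with hh
  have hsm : ContDiff ℝ 1 h := contDiff_annular (k := 1) (hχ.of_le (by simp)) h1 hHN
  have hcs : HasCompactSupport h := hasCompactSupport_annular h3 _
  have hzero : ∫ y, fderiv ℝ h y v = 0 := by
    have hc : Continuous fun y => fderiv ℝ h y v :=
      (hsm.continuous_fderiv (by simp)).clm_apply continuous_const
    have hcs' : HasCompactSupport fun y => fderiv ℝ h y v := hcs.fderiv_apply ℝ v
    have := integral_mul_fderiv_eq_neg_fderiv_mul_of_integrable (μ := volume)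
      (f := fun _ : Euc n => (1 : ℂ)) (g := h) (v := v) (by simp)
      (by simpa using hc.integrable_of_hasCompactSupport hcs')
      (by simpa using hsm.continuous.integrable_of_hasCompactSupport hcs) (by simp)
      (fun x _ => hsm.differentiable (by simp) x)
    simpa using this
  have hd1 : ∀ r < 1, deriv χ r = 0 := fun r hr => by
    have : χ =ᶠ[𝓝 r] fun _ => 0 := by
      filter_upwards [Iio_mem_nhds hr] with s hs using h1 s hs
    rw [this.deriv_eq]; simp
  have hd3 : ∀ r, 3 < r → deriv χ r = 0 := fun r hr => by
    have : χ =ᶠ[𝓝 r] fun _ => 0 := by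
      filter_upwards [Ioi_mem_nhds hr] with s hs using h3 s hs
    rw [this.deriv_eq]; simp
  set f₁ : Euc n → ℂ := fun y => deriv χ ‖y‖ • (inner ℝ (N y) v • H (N y)) with hf₁
  have hf₁i : Integrable f₁ := by
    have hc : ContDiff ℝ (0 : ℕ∞) f₁ := by
      refine contDiff_annular (contDiff_zero.2 (hχ.continuous_deriv (by simp))) hd1 fun y hy => ?_
      have i1 : ContDiffAt ℝ ((0 : ℕ∞) : WithTop ℕ∞) (fun y => inner ℝ (N y) v) y :=
        ((contDiffAt_direction hy).of_le (by simp)).inner ℝ contDiffAt_const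
      exact i1.smul ((hHN y hy).of_le (by simp))
    exact hc.continuous.integrable_of_hasCompactSupport (hasCompactSupport_annular hd3 _)
  have hfi : Integrable fun y => fderiv ℝ h y v :=
    ((hsm.continuous_fderiv (by simp)).clm_apply continuous_const).integrable_of_hasCompactSupport
      (hcs.fderiv_apply ℝ v)
  have hray : ∀ (u : Sph n) (r : ℝ), 0 < r → N (r • (u : Euc n)) = u := fun u r hr => by
    have hu : ‖(u : Euc n)‖ = 1 := by simp
    simp [hN, norm_smul, hu, abs_of_pos hr, smul_smul, hr.ne']
  have hnr : ∀ (u : Sph n) (r : ℝ), 0 < r → ‖r • (u : Euc n)‖ = r := fun u r hr => by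
    have hu : ‖(u : Euc n)‖ = 1 := by simp
    simp [norm_smul, hu, abs_of_pos hr]
  -- The product rule along a ray: `f₁` carries the derivative of the cutoff, the other term the
  -- tangential derivative of `H`. Each of them separates into a function of `u` times a function of
  -- `r`.
  have hder : ∀ (u : Sph n) (r : ℝ), 0 < r → fderiv ℝ h (r • (u : Euc n)) v =
      f₁ (r • (u : Euc n)) +
        (r⁻¹ * χ r) • fderiv ℝ H u (v - inner ℝ (u : Euc n) v • (u : Euc n)) := by
    intro u r hr
    have hu : ‖(u : Euc n)‖ = 1 := by simp
    have hu0 : (u : Euc n) ≠ 0 := fun h => by simp [h] at hu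
    have hru : r • (u : Euc n) ≠ 0 := by simp [hr.ne', hu0]
    have hHd : HasFDerivAt H (fderiv ℝ H u) (N (r • (u : Euc n))) := by
      rw [hray u r hr]
      exact ((hH u hu0).differentiableAt (by simp)).hasFDerivAt
    have hNd : HasFDerivAt N (fderiv ℝ N (r • (u : Euc n))) (r • (u : Euc n)) :=
      ((contDiffAt_direction hru).differentiableAt (by simp)).hasFDerivAt
    have hχd : HasDerivAt χ (deriv χ r) ‖r • (u : Euc n)‖ := by
      rw [hnr u r hr]
      exact (hχ.differentiable (by simp) r).hasDerivAt
    have := ((hχd.comp_hasFDerivAt _ (hasFDerivAt_norm_ray u hr)).smul (hHd.comp _ hNd)).fderiv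
    have h' : fderiv ℝ h (r • (u : Euc n)) = _ := this
    rw [h']
    simp only [hf₁, Function.comp_apply, hray u r hr, hnr u r hr, add_apply, smul_apply,
      ContinuousLinearMap.comp_apply, ContinuousLinearMap.smulRight_apply, innerSL_apply_apply]
    rw [hN, hasFDerivAt_direction_ray u hr v, map_smul, smul_smul, smul_eq_mul, mul_comm (χ r),
      smul_smul]
    abel
  have p1 := integral_polar (f := f₁)
    (a := fun u => inner ℝ (u : Euc n) v • H u) (b := deriv χ) (fun u r hr => by
      simp only [hf₁, hray u r hr, hnr u r hr, Complex.real_smul]; ring)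
  have p2 := integral_polar (f := fun y => fderiv ℝ h y v - f₁ y)
    (a := fun u : Sph n => fderiv ℝ H u (v - inner ℝ (u : Euc n) v • (u : Euc n)))
    (b := fun r => r⁻¹ * χ r) (fun u r hr => by
      rw [hder u r hr, Complex.real_smul]; ring)
  rw [integral_sub hfi hf₁i, hzero, p1, integral_radial_deriv hn hχ h1 h3] at p2
  have hc : (∫ r in Ioi (0 : ℝ), r ^ (n - 1) * (r⁻¹ * χ r)) ≠ 0 := by
    have hcont : Continuous fun r : ℝ => r ^ (n - 1) * (r⁻¹ * χ r) := by
      obtain ⟨m, rfl⟩ : ∃ m, n = m + 2 := ⟨n - 2, by omega⟩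
      have : (fun r : ℝ => r ^ (m + 2 - 1) * (r⁻¹ * χ r)) = fun r => r ^ m * χ r := by
        funext r
        by_cases hr : r = 0
        · subst hr; simp [h1 0 one_pos]
        · simp only [Nat.add_succ_sub_one, pow_succ]; field_simp
      rw [this]
      have := hχ.continuous
      fun_prop
    have hcs : HasCompactSupport fun r : ℝ => r ^ (n - 1) * (r⁻¹ * χ r) :=
      HasCompactSupport.intro (isCompact_Icc (a := (1 : ℝ)) (b := 3)) fun r hr => by
        simp only [mem_Icc, not_and_or, not_le] at hr
        rcases hr with hr | hr
        · simp [h1 r hr]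
        · simp [h3 r hr]
    rw [setIntegral_eq_integral_of_forall_compl_eq_zero fun r hr => by
      rw [h1 r (lt_of_le_of_lt (not_lt.1 hr) one_pos), mul_zero, mul_zero]]
    refine (hcont.integral_pos_of_hasCompactSupport_nonneg_nonzero hcs (x := 2) (fun r => ?_)
      (by simp [h2])).ne'
    rcases lt_or_ge r 1 with hr | hr
    · simp [h1 r hr]
    · have := hpos r
      have : 0 ≤ r := by linarith
      simp only [Pi.zero_apply]
      positivity
  have hcont : ∀ (w : Sph n → Euc n) (hw : Continuous w),
      Continuous fun u : Sph n => fderiv ℝ H u (w u) := fun w hw => by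
    refine Continuous.clm_apply ?_ hw
    rw [continuous_iff_continuousAt]
    intro u
    have hu : ‖(u : Euc n)‖ = 1 := by simp
    have hu0 : (u : Euc n) ≠ 0 := fun h => by simp [h] at hu
    exact ((hH u hu0).continuousAt_fderiv (by simp)).comp continuous_subtype_val.continuousAt
  have hcontH : Continuous fun u : Sph n => H u := by
    rw [continuous_iff_continuousAt]
    intro u
    have hu : ‖(u : Euc n)‖ = 1 := by simp
    have hu0 : (u : Euc n) ≠ 0 := fun h => by simp [h] at hu
    exact (hH u hu0).continuousAt.comp continuous_subtype_val.continuousAt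
  have key : (∫ u : Sph n, fderiv ℝ H u (v - inner ℝ (u : Euc n) v • (u : Euc n)) ∂(surf n)) -
      (n - 1 : ℝ) • ∫ u : Sph n, inner ℝ (u : Euc n) v • H u ∂(surf n) = 0 := by
    -- After the radial integration by parts both terms contain the same radial integral, which can
    -- be cancelled.
    have hc' : ((∫ r in Ioi (0 : ℝ), r ^ (n - 1) * (r⁻¹ * χ r) : ℝ) : ℂ) ≠ 0 := by
      exact_mod_cast hc
    apply mul_right_cancel₀ hc'
    rw [sub_mul, ← p2, Complex.real_smul]
    push_cast
    ring
  rw [← integral_smul, ← integral_sub] at key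
  · rw [← key]
    refine integral_congr_ae (Eventually.of_forall fun u => ?_)
    simp only [map_sub, map_smul, smul_smul]
  · exact (hcont _ (by fun_prop)).integrable_of_hasCompactSupport (HasCompactSupport.of_compactSpace _)
  · refine Continuous.integrable_of_hasCompactSupport ?_ (HasCompactSupport.of_compactSpace _)
    have hi : Continuous fun u : Sph n => inner ℝ (u : Euc n) v :=
      continuous_subtype_val.inner continuous_const
    exact (hi.fun_smul hcontH).const_smul (n - 1 : ℝ)

theorem coe_sphere_ne_zero {n : ℕ} (u : Sph n) : (u : Euc n) ≠ 0 := fun h => by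
  have hu : ‖(u : Euc n)‖ = 1 := by simp
  simp [h] at hu

theorem continuous_sphere_of_ne_zero {n : ℕ} {X : Type*} [TopologicalSpace X] {f : Euc n → X}
    (h : ∀ y ≠ 0, ContinuousAt f y) : Continuous fun u : Sph n => f u :=
  continuous_iff_continuousAt.2 fun u =>
    (h u (coe_sphere_ne_zero u)).comp continuous_subtype_val.continuousAt

theorem integrable_sphere {n : ℕ} {F : Type*} [NormedAddCommGroup F] {f : Sph n → F}
    (h : Continuous f) : Integrable f (surf n) :=
  h.integrable_of_hasCompactSupport (HasCompactSupport.of_compactSpace _)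

/-- Euler's relation in degree `0`; constancy along the single ray through `u` suffices. -/
theorem fderiv_self_eq_zero {n : ℕ} {F : Type*} [NormedAddCommGroup F] [NormedSpace ℝ F]
    {H : Euc n → F} (u : Euc n) (hd : DifferentiableAt ℝ H u)
    (hom : ∀ t : ℝ, 0 < t → H (t • u) = H u) : fderiv ℝ H u u = 0 := by
  have h1 : HasDerivAt (fun t : ℝ => t • u) u 1 := by
    simpa using (hasDerivAt_id (1 : ℝ)).smul_const u
  have h2 : HasFDerivAt H (fderiv ℝ H u) ((1 : ℝ) • u) := by simpa using hd.hasFDerivAt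
  have h3 := h2.comp_hasDerivAt (1 : ℝ) h1
  have h4 : (H ∘ fun t : ℝ => t • u) =ᶠ[𝓝 1] fun _ => H u := by
    filter_upwards [Ioi_mem_nhds one_pos] with t ht using hom t ht
  exact (h3.congr_of_eventuallyEq h4.symm).unique (hasDerivAt_const _ _)

/-- The divergence theorem on the sphere for a tangential `1`-form. -/
theorem integral_sphere_tangential {n : ℕ} [Fact (2 ≤ n)] {K : Euc n → Euc n →L[ℝ] ℂ}
    (hK : ∀ y ≠ 0, ContDiffAt ℝ 1 K y) (ht : ∀ y ≠ 0, K y y = 0) :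
    ∫ u : Sph n, ∑ i, fderiv ℝ K u (EuclideanSpace.basisFun (Fin n) ℝ i)
      (EuclideanSpace.basisFun (Fin n) ℝ i) ∂(surf n) = 0 := by
  set e := EuclideanSpace.basisFun (Fin n) ℝ with he
  have hder : ∀ (u : Sph n) (i : Fin n) (w : Euc n),
      fderiv ℝ (fun y => K y (e i)) u w = fderiv ℝ K u w (e i) := fun u i w => by
    have := ((hK u (coe_sphere_ne_zero u)).differentiableAt (by simp)).hasFDerivAt.clm_apply
      (hasFDerivAt_const (e i) (u : Euc n))
    rw [this.fderiv]
    simp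
  have hc : ∀ w : Sph n → Euc n, Continuous w → ∀ i,
      Continuous fun u : Sph n => fderiv ℝ K u (w u) (e i) := fun w hw i => by
    have : Continuous fun u : Sph n => fderiv ℝ K u :=
      continuous_sphere_of_ne_zero fun y hy => (hK y hy).continuousAt_fderiv (by simp)
    exact (this.clm_apply hw).clm_apply continuous_const
  have hcK : ∀ i, Continuous fun u : Sph n => K u (e i) := fun i =>
    continuous_sphere_of_ne_zero fun y hy => (hK y hy).continuousAt.clm_apply continuousAt_const
  have hi : ∀ i, Continuous fun u : Sph n => inner ℝ (u : Euc n) (e i) := fun i =>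
    continuous_subtype_val.inner continuous_const
  have hD : ∀ i, ∫ u : Sph n, (fderiv ℝ K u (e i) (e i)
      - inner ℝ (u : Euc n) (e i) • fderiv ℝ K u u (e i)
      - ((n - 1 : ℝ) * inner ℝ (u : Euc n) (e i)) • K u (e i)) ∂(surf n) = 0 := fun i => by
    have := integral_sphere_fderiv (H := fun y => K y (e i))
      (fun y hy => (hK y hy).clm_apply contDiffAt_const) (e i)
    simpa only [hder] using this
  have hsum : ∀ (L : Euc n →L[ℝ] ℂ) (u : Euc n), ∑ i, inner ℝ u (e i) • L (e i) = L u :=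
    fun L u => by
      conv_rhs => rw [← e.sum_repr' u]
      simp only [map_sum, map_smul, real_inner_comm]
  -- Tangentiality at `t • u` gives `K (t • u) u = 0` for all `t > 0`, so the derivative of this
  -- expression along the ray vanishes. With `K u u = 0`, this removes both correction terms once
  -- the directions `e i` are summed.
  have hself : ∀ u : Sph n, fderiv ℝ K u u u = 0 := fun u => by
    have h1 : DifferentiableAt ℝ (fun y => K y (u : Euc n)) (u : Euc n) :=
      ((hK u (coe_sphere_ne_zero u)).differentiableAt (by simp)).clm_apply
        (differentiableAt_const _)
    have h0 : ∀ t : ℝ, 0 < t → K (t • (u : Euc n)) (u : Euc n) = 0 := fun t ht0 => by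
      have := ht (t • (u : Euc n)) (by simp [ht0.ne', coe_sphere_ne_zero u])
      rw [map_smul] at this
      exact (smul_eq_zero.1 this).resolve_left ht0.ne'
    have h2 := fderiv_self_eq_zero (H := fun y => K y (u : Euc n)) u h1 fun t ht0 => by
      rw [h0 t ht0]
      have := h0 1 one_pos
      rw [one_smul] at this
      exact this.symm
    have h3 := ((hK u (coe_sphere_ne_zero u)).differentiableAt (by simp)).hasFDerivAt.clm_apply
      (hasFDerivAt_const (u : Euc n) (u : Euc n))
    rw [h3.fderiv] at h2
    simpa using h2
  have h0 := Finset.sum_eq_zero fun i (_ : i ∈ Finset.univ) => hD i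
  have hint : ∀ i, Integrable (fun u : Sph n => fderiv ℝ K u (e i) (e i)
      - inner ℝ (u : Euc n) (e i) • fderiv ℝ K u u (e i)
      - ((n - 1 : ℝ) * inner ℝ (u : Euc n) (e i)) • K u (e i)) (surf n) := fun i =>
    integrable_sphere
      (((hc _ continuous_const i).sub ((hi i).fun_smul (hc _ continuous_subtype_val i))).sub
        (((hi i).const_mul (n - 1 : ℝ)).fun_smul (hcK i)))
  rw [← integral_finsetSum _ fun i _ => hint i] at h0
  rw [← h0]
  refine integral_congr_ae (Eventually.of_forall fun u => ?_)
  simp only [Finset.sum_sub_distrib, mul_smul]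
  rw [hsum (fderiv ℝ K u u) u, ← Finset.smul_sum, hsum (K u) u, hself, ht u (coe_sphere_ne_zero u)]
  simp

/-! ### Symmetry of the Laplace–Beltrami operator and the hyperplane identity -/

theorem laplacian_eq_sum_fderiv {n : ℕ} (F : Euc n → ℂ) (y : Euc n) :
    Laplacian.laplacian F y = ∑ i, fderiv ℝ (fderiv ℝ F) y (EuclideanSpace.basisFun (Fin n) ℝ i)
      (EuclideanSpace.basisFun (Fin n) ℝ i) := by
  rw [InnerProductSpace.laplacian_eq_iteratedFDeriv_orthonormalBasis F
    (EuclideanSpace.basisFun (Fin n) ℝ)]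
  simp only [iteratedFDeriv_two_apply]
  simp

/-- The Laplace–Beltrami operator is symmetric. -/
theorem integral_laplacian_mul_comm {n : ℕ} [Fact (2 ≤ n)] {F H : Euc n → ℂ}
    (hF : ∀ y ≠ 0, ContDiffAt ℝ ∞ F y) (hH : ∀ y ≠ 0, ContDiffAt ℝ ∞ H y)
    (hF0 : ∀ t : ℝ, 0 < t → ∀ y, F (t • y) = F y) (hH0 : ∀ t : ℝ, 0 < t → ∀ y, H (t • y) = H y) :
    ∫ u : Sph n, Laplacian.laplacian F u * H u ∂(surf n) =
      ∫ u : Sph n, F u * Laplacian.laplacian H u ∂(surf n) := by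
  have hdF : ∀ y ≠ 0, ContDiffAt ℝ ∞ (fderiv ℝ F) y := fun y hy =>
    (hF y hy).fderiv_right (by simp)
  have hdH : ∀ y ≠ 0, ContDiffAt ℝ ∞ (fderiv ℝ H) y := fun y hy =>
    (hH y hy).fderiv_right (by simp)
  have hlap : ∀ {G : Euc n → ℂ}, (∀ y ≠ 0, ContDiffAt ℝ ∞ G y) →
      Continuous fun u : Sph n => Laplacian.laplacian G u := fun {G} hG => by
    have hd : ∀ y ≠ 0, ContDiffAt ℝ ∞ (fderiv ℝ (fderiv ℝ G)) y := fun y hy =>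
      ((hG y hy).fderiv_right (m := ∞) (by simp)).fderiv_right (by simp)
    simp only [laplacian_eq_sum_fderiv]
    refine continuous_finsetSum _ fun i _ => continuous_sphere_of_ne_zero
      (f := fun y => fderiv ℝ (fderiv ℝ G) y _ _) fun y hy => ?_
    exact ((hd y hy).continuousAt.clm_apply continuousAt_const).clm_apply continuousAt_const
  have hcF : Continuous fun u : Sph n => F u :=
    continuous_sphere_of_ne_zero fun y hy => (hF y hy).continuousAt
  have hcH : Continuous fun u : Sph n => H u :=
    continuous_sphere_of_ne_zero fun y hy => (hH y hy).continuousAt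
  -- Green's second identity: the form `H dF - F dH` is tangential by homogeneity, and the products
  -- of first derivatives cancel in its divergence.
  have key := integral_sphere_tangential (K := fun y => H y • fderiv ℝ F y - F y • fderiv ℝ H y)
    (fun y hy => (((hH y hy).smul (hdF y hy)).sub ((hF y hy).smul (hdH y hy))).of_le (by simp))
    (fun y hy => by
      have h1 := fderiv_self_eq_zero y ((hF y hy).differentiableAt (by simp))
        fun t ht => hF0 t ht y
      have h2 := fderiv_self_eq_zero y ((hH y hy).differentiableAt (by simp))
        fun t ht => hH0 t ht y
      simp [h1, h2])
  have i1 : Integrable (fun u : Sph n => Laplacian.laplacian F u * H u) (surf n) :=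
    integrable_sphere ((hlap hF).mul hcH)
  have i2 : Integrable (fun u : Sph n => F u * Laplacian.laplacian H u) (surf n) :=
    integrable_sphere (hcF.mul (hlap hH))
  rw [← sub_eq_zero, ← integral_sub i1 i2, ← key]
  refine integral_congr_ae (Eventually.of_forall fun u => ?_)
  have hu := coe_sphere_ne_zero u
  have h := ((((hH u hu).differentiableAt (by simp)).hasFDerivAt.smul
    ((hdF u hu).differentiableAt (by simp)).hasFDerivAt).sub
    (((hF u hu).differentiableAt (by simp)).hasFDerivAt.smul
    ((hdH u hu).differentiableAt (by simp)).hasFDerivAt)).fderiv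
  have h' : fderiv ℝ (fun y => H y • fderiv ℝ F y - F y • fderiv ℝ H y) (u : Euc n) = _ := h
  simp only [h', laplacian_eq_sum_fderiv, Finset.sum_mul, Finset.mul_sum, ← Finset.sum_sub_distrib]
  refine Finset.sum_congr rfl fun i _ => ?_
  simp
  ring

/-- The identity which relates the Laplace–Beltrami operator to the Radon kernel: the integral
over the sphere of `Δ_u P (u, s)`, evaluated at `s = ⟪x, u⟫`. -/
theorem integral_laplacian_hyperplane {n : ℕ} [Fact (2 ≤ n)] {P : Euc n × ℝ → ℂ}
    (hP : ∀ z : Euc n × ℝ, z.1 ≠ 0 → ContDiffAt ℝ ∞ P z)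
    (hom : ∀ t : ℝ, 0 < t → ∀ y s, P (t • y, s) = P (y, s)) (x : Euc n) :
    ∫ u : Sph n, (Laplacian.laplacian (fun y => P (y, inner ℝ x (u : Euc n))) u
      - ((‖x‖ ^ 2 - inner ℝ x (u : Euc n) ^ 2 : ℝ) : ℂ) *
        deriv (deriv fun s => P (u, s)) (inner ℝ x (u : Euc n))
      + ((n - 1 : ℝ) * inner ℝ x (u : Euc n) : ℝ) *
        deriv (fun s => P (u, s)) (inner ℝ x (u : Euc n))) ∂(surf n) = 0 := by
  set e := EuclideanSpace.basisFun (Fin n) ℝ with he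
  have hA : ∀ z : Euc n × ℝ, z.1 ≠ 0 → ContDiffAt ℝ ∞ (fderiv ℝ P) z := fun z hz =>
    (hP z hz).fderiv_right (by simp)
  have hB : ∀ z : Euc n × ℝ, z.1 ≠ 0 → ContDiffAt ℝ ∞ (fderiv ℝ (fderiv ℝ P)) z := fun z hz =>
    (hA z hz).fderiv_right (by simp)
  set γ : Euc n → Euc n × ℝ := fun y => (y, inner ℝ x y) with hγ
  have hγs : ContDiff ℝ ∞ γ := contDiff_id.prodMk (contDiff_const.inner ℝ contDiff_id)
  have hγd : ∀ y, HasFDerivAt γ ((ContinuousLinearMap.id ℝ (Euc n)).prod (innerSL ℝ x)) y :=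
    fun y => (hasFDerivAt_id y).prodMk (innerSL ℝ x).hasFDerivAt
  have hAd : ∀ z : Euc n × ℝ, z.1 ≠ 0 → HasFDerivAt (fderiv ℝ P) (fderiv ℝ (fderiv ℝ P) z) z :=
    fun z hz => ((hA z hz).differentiableAt (by simp)).hasFDerivAt
  have hPd : ∀ z : Euc n × ℝ, z.1 ≠ 0 → HasFDerivAt P (fderiv ℝ P z) z :=
    fun z hz => ((hP z hz).differentiableAt (by simp)).hasFDerivAt
  have hAγ : ∀ y ≠ 0, ContDiffAt ℝ ∞ (fun y => fderiv ℝ P (γ y)) y := fun y hy =>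
    (hA (γ y) hy).comp y hγs.contDiffAt
  have hAγd : ∀ y ≠ 0, HasFDerivAt (fun y => fderiv ℝ P (γ y)) ((fderiv ℝ (fderiv ℝ P) (γ y)).comp
      ((ContinuousLinearMap.id ℝ (Euc n)).prod (innerSL ℝ x))) y := fun y hy =>
    (hAd (γ y) hy).comp y (hγd y)
  have hBc : ∀ v w : Sph n → Euc n × ℝ, Continuous v → Continuous w →
      Continuous fun u : Sph n => fderiv ℝ (fderiv ℝ P) (γ u) (v u) (w u) := fun v w hv hw => by
    have : Continuous fun u : Sph n => fderiv ℝ (fderiv ℝ P) (γ u) :=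
      continuous_sphere_of_ne_zero (f := fun y => fderiv ℝ (fderiv ℝ P) (γ y)) fun y hy =>
        ((hB (γ y) hy).comp y hγs.contDiffAt).continuousAt
    exact (this.clm_apply hv).clm_apply hw
  have hi : Continuous fun u : Sph n => inner ℝ x (u : Euc n) :=
    continuous_const.inner continuous_subtype_val
  -- the derivatives of `P` in each variable
  have hs1 : ∀ (y : Euc n) (_ : y ≠ 0) (s : ℝ),
      HasDerivAt (fun s => P (y, s)) (fderiv ℝ P (y, s) (0, 1)) s := fun y hy s =>
    (hPd (y, s) hy).comp_hasDerivAt s ((hasDerivAt_const s y).prodMk (hasDerivAt_id s))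
  have hs2 : ∀ (y : Euc n) (_ : y ≠ 0) (s : ℝ), deriv (deriv fun s => P (y, s)) s =
      fderiv ℝ (fderiv ℝ P) (y, s) (0, 1) (0, 1) := fun y hy s => by
    have h1 : (deriv fun s => P (y, s)) = fun s => fderiv ℝ P (y, s) (0, 1) :=
      funext fun s => (hs1 y hy s).deriv
    rw [h1]
    have h2 := (hAd (y, s) hy).comp_hasDerivAt s ((hasDerivAt_const s y).prodMk (hasDerivAt_id s))
    have h3 := h2.clm_apply (hasDerivAt_const s ((0, 1) : Euc n × ℝ))
    simpa using h3.deriv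
  have hinl : ∀ (s : ℝ) (y : Euc n), HasFDerivAt (fun y : Euc n => (y, s))
      (ContinuousLinearMap.inl ℝ (Euc n) ℝ) y := fun s y => by
    simpa [ContinuousLinearMap.inl] using (hasFDerivAt_id y).prodMk (hasFDerivAt_const s y)
  have hlap : ∀ (y : Euc n) (_ : y ≠ 0) (s : ℝ), Laplacian.laplacian (fun y => P (y, s)) y =
      ∑ i, fderiv ℝ (fderiv ℝ P) (y, s) (e i, 0) (e i, 0) := fun y hy s => by
    rw [laplacian_eq_sum_fderiv]
    refine Finset.sum_congr rfl fun i _ => ?_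
    have h1 : fderiv ℝ (fun y => P (y, s)) =ᶠ[𝓝 y]
        fun y => (fderiv ℝ P (y, s)).comp (ContinuousLinearMap.inl ℝ (Euc n) ℝ) := by
      filter_upwards [isOpen_ne.mem_nhds hy] with w hw
      exact ((hPd (w, s) hw).comp w (hinl s w)).fderiv
    rw [h1.fderiv_eq]
    have h2 := ((hAd (y, s) hy).comp y (hinl s y)).clm_comp
      (hasFDerivAt_const (ContinuousLinearMap.inl ℝ (Euc n) ℝ) y)
    have h2' : fderiv ℝ (fun y => (fderiv ℝ P (y, s)).comp
      (ContinuousLinearMap.inl ℝ (Euc n) ℝ)) y = _ := h2.fderiv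
    rw [h2']
    simp [he]
  -- the two tangential fields
  have hrad : ∀ u : Sph n, ∀ s, fderiv ℝ (fderiv ℝ P) ((u : Euc n), s) ((u : Euc n), 0) (0, 1) = 0 :=
    fun u s => by
      have hu := coe_sphere_ne_zero u
      have h2 := ((hAd ((u : Euc n), s) hu).comp (u : Euc n) (hinl s u)).clm_apply
        (hasFDerivAt_const ((0, 1) : Euc n × ℝ) (u : Euc n))
      have h3 := fderiv_self_eq_zero (H := fun y => fderiv ℝ P (y, s) (0, 1)) (u : Euc n)
        h2.differentiableAt fun t ht => by
          rw [← (hs1 (t • (u : Euc n)) (by simp [ht.ne', hu]) s).deriv, ← (hs1 u hu s).deriv]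
          simp only [hom t ht]
      have h2' : fderiv ℝ (fun y => fderiv ℝ P (y, s) (0, 1)) (u : Euc n) = _ := h2.fderiv
      rw [h2'] at h3
      simpa using h3
  -- The gradient of `P` in its first variable, evaluated at `s = ⟪x, y⟫`. By the chain rule its
  -- divergence is the Laplacian plus the mixed derivative of `P` in the direction `x` and in `s`.
  have k1 := integral_sphere_tangential
    (K := fun y => (fderiv ℝ P (γ y)).comp (ContinuousLinearMap.inl ℝ (Euc n) ℝ))
    (fun y hy => ((hAγ y hy).clm_comp contDiffAt_const).of_le (by simp)) (fun y hy => by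
      have h1 := (hPd (y, inner ℝ x y) hy).comp y (hinl (inner ℝ x y) y)
      have h2 := fderiv_self_eq_zero (H := fun z => P (z, inner ℝ x y)) y h1.differentiableAt
        fun t ht => hom t ht _ _
      have h1' : fderiv ℝ (fun z => P (z, inner ℝ x y)) y = _ := h1.fderiv
      rw [h1'] at h2
      exact h2)
  rw [← he] at k1
  -- The function `∂ₛ P` at `s = ⟪x, y⟫`, differentiated along `x`, produces the same mixed
  -- derivative. Subtraction eliminates it and leaves `∂ₛ² P` with the factor `‖x‖² - s²`, the
  -- squared length of the tangential part of `x`.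
  have k2 := integral_sphere_fderiv (H := fun y => fderiv ℝ P (γ y) (0, 1))
    (fun y hy => ((hAγ y hy).clm_apply contDiffAt_const).of_le (by simp)) x
  have d1 : ∀ (u : Sph n) (i : Fin n), fderiv ℝ (fun y => (fderiv ℝ P (γ y)).comp
      (ContinuousLinearMap.inl ℝ (Euc n) ℝ)) u (e i) (e i) =
      fderiv ℝ (fderiv ℝ P) (γ u) (e i, 0) (e i, 0) +
      inner ℝ x (e i) • fderiv ℝ (fderiv ℝ P) (γ u) (e i, 0) (0, 1) := fun u i => by
    have hu := coe_sphere_ne_zero u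
    have h1 := (hAγd u hu).clm_comp
      (hasFDerivAt_const (ContinuousLinearMap.inl ℝ (Euc n) ℝ) (u : Euc n))
    rw [h1.fderiv]
    have hsymm : IsSymmSndFDerivAt ℝ P (γ u) := (hP (γ u) hu).isSymmSndFDerivAt
      (by rw [minSmoothness_of_isRCLikeNormedField]; exact WithTop.coe_le_coe.2 le_top)
    have e1 : (e i, inner ℝ x (e i)) = ((e i, 0) : Euc n × ℝ) + inner ℝ x (e i) • (0, 1) := by
      simp
    rw [hsymm.eq (e i, 0) (0, 1)]
    simp only [_root_.add_apply, ContinuousLinearMap.comp_apply,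
      ContinuousLinearMap.compL_apply, ContinuousLinearMap.flip_apply,
      ContinuousLinearMap.prod_apply, ContinuousLinearMap.id_apply, innerSL_apply_apply,
      ContinuousLinearMap.inl_apply, _root_.zero_apply, ContinuousLinearMap.comp_zero]
    rw [e1, map_add, map_smul]
    simp
  have d2 : ∀ (u : Sph n) (w : Euc n), fderiv ℝ (fun y => fderiv ℝ P (γ y) (0, 1)) u w =
      fderiv ℝ (fderiv ℝ P) (γ u) (w, 0) (0, 1) +
      inner ℝ x w • fderiv ℝ (fderiv ℝ P) (γ u) (0, 1) (0, 1) := fun u w => by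
    have h1 := (hAγd u (coe_sphere_ne_zero u)).clm_apply
      (hasFDerivAt_const ((0, 1) : Euc n × ℝ) (u : Euc n))
    have e1 : (w, inner ℝ x w) = ((w, 0) : Euc n × ℝ) + inner ℝ x w • (0, 1) := by
      simp
    rw [h1.fderiv]
    simp only [ContinuousLinearMap.comp_apply,
      ContinuousLinearMap.flip_apply, ContinuousLinearMap.prod_apply, ContinuousLinearMap.id_apply,
      innerSL_apply_apply, ContinuousLinearMap.comp_zero, zero_add]
    rw [e1, map_add, map_smul]
    simp
  simp only [d1] at k1
  simp only [d2, real_inner_comm x] at k2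
  have hxsum : ∀ u : Sph n, ∑ i, inner ℝ x (e i) • fderiv ℝ (fderiv ℝ P) (γ u) (e i, 0) (0, 1) =
      fderiv ℝ (fderiv ℝ P) (γ u) (x, 0) (0, 1) := fun u => by
    have e2 : ((x, 0) : Euc n × ℝ) = ∑ i, inner ℝ x (e i) • (e i, (0 : ℝ)) := by
      have := congrArg (ContinuousLinearMap.inl ℝ (Euc n) ℝ) (e.sum_repr' x)
      simp only [map_sum, map_smul, real_inner_comm, ContinuousLinearMap.inl_apply] at this
      exact this.symm
    rw [e2, map_sum, _root_.sum_apply]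
    simp only [map_smul, _root_.smul_apply]
  have i1 : Integrable (fun u : Sph n => ∑ i, (fderiv ℝ (fderiv ℝ P) (γ u) (e i, 0) (e i, 0) +
      inner ℝ x (e i) • fderiv ℝ (fderiv ℝ P) (γ u) (e i, 0) (0, 1))) (surf n) :=
    integrable_sphere <| continuous_finsetSum _ fun i _ =>
      (hBc _ _ continuous_const continuous_const).add
        ((hBc _ _ continuous_const continuous_const).const_smul (inner ℝ x (e i)))
  have hγu : Continuous fun u : Sph n => ((u : Euc n), (0 : ℝ)) :=
    continuous_subtype_val.prodMk continuous_const
  have hAc : Continuous fun u : Sph n => fderiv ℝ P (γ u) (0, 1) :=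
    continuous_sphere_of_ne_zero (f := fun y => fderiv ℝ P (γ y) (0, 1)) fun y hy =>
      (hAγ y hy).continuousAt.clm_apply continuousAt_const
  have i2 : Integrable (fun u : Sph n => fderiv ℝ (fderiv ℝ P) (γ u) (x, 0) (0, 1) +
      inner ℝ x x • fderiv ℝ (fderiv ℝ P) (γ u) (0, 1) (0, 1)
      - inner ℝ x (u : Euc n) • (fderiv ℝ (fderiv ℝ P) (γ u) ((u : Euc n), 0) (0, 1) +
        inner ℝ x (u : Euc n) • fderiv ℝ (fderiv ℝ P) (γ u) (0, 1) (0, 1))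
      - ((n - 1 : ℝ) * inner ℝ x (u : Euc n)) • fderiv ℝ P (γ u) (0, 1)) (surf n) :=
    integrable_sphere <|
      (((hBc _ _ continuous_const continuous_const).add
        ((hBc _ _ continuous_const continuous_const).const_smul (inner ℝ x x))).sub
        (hi.fun_smul ((hBc _ _ hγu continuous_const).add
          (hi.fun_smul (hBc _ _ continuous_const continuous_const))))).sub
        ((hi.const_mul (n - 1 : ℝ)).fun_smul hAc)
  have k3 := (integral_sub i1 i2).trans (by rw [k1, k2, sub_zero])
  rw [← k3]
  refine integral_congr_ae (Eventually.of_forall fun u => ?_)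
  have hu := coe_sphere_ne_zero u
  have hγ' : γ u = ((u : Euc n), inner ℝ x (u : Euc n)) := rfl
  simp only [hlap u hu, hs2 u hu, (hs1 u hu _).deriv, Finset.sum_add_distrib, hrad u, hγ',
    real_inner_self_eq_norm_sq, Complex.real_smul]
  have hx' := hxsum u
  simp only [hγ', Complex.real_smul] at hx'
  rw [hx']
  push_cast
  ring

/-! ### Rapidly decaying functions and their primitives in `p` -/

/-- Continuous functions on the cylinder which decay rapidly, uniformly in the spherical variable. -/
structure RapidDecay {n : ℕ} (f : Sph n × ℝ → ℂ) : Prop where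
  cont : Continuous f
  bound : ∀ r : ℕ, ∃ C : ℝ, ∀ z, (1 + z.2 ^ 2) ^ r * ‖f z‖ ≤ C

/-- All the moments in the real variable vanish. -/
def MomentFree {n : ℕ} (f : Sph n × ℝ → ℂ) : Prop :=
  ∀ (u : Sph n) (k : ℕ), ∫ p : ℝ, ((p ^ k : ℝ) : ℂ) * f (u, p) = 0

/-- The primitive in the real variable which vanishes at `-∞`. -/
def primitive {n : ℕ} (f : Sph n × ℝ → ℂ) (z : Sph n × ℝ) : ℂ := ∫ q in Iic z.2, f (z.1, q)

theorem abs_pow_le_one_add_sq_pow (p : ℝ) (k : ℕ) : |p| ^ k ≤ (1 + p ^ 2) ^ k := by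
  refine pow_le_pow_left₀ (abs_nonneg p) ?_ k
  nlinarith [sq_abs p, sq_nonneg (|p| - 1)]

namespace RapidDecay

variable {n : ℕ} {f : Sph n × ℝ → ℂ}

/-- One spare power of the weight supplies the integrable majorant `(1 + p²)⁻¹` used in all
dominated convergence arguments. -/
theorem exists_norm_le (hf : RapidDecay f) (r : ℕ) :
    ∃ C : ℝ, 0 ≤ C ∧ ∀ z, (1 + z.2 ^ 2) ^ r * ‖f z‖ ≤ C * (1 + z.2 ^ 2)⁻¹ := by
  obtain ⟨C, hC⟩ := hf.bound (r + 1)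
  refine ⟨max C 0, le_max_right _ _, fun z => ?_⟩
  have hpos : 0 < 1 + z.2 ^ 2 := by positivity
  rw [← div_eq_mul_inv, le_div_iff₀ hpos]
  refine le_trans (le_of_eq ?_) ((hC z).trans (le_max_left _ _))
  ring

theorem cont_slice (hf : RapidDecay f) (u : Sph n) : Continuous fun p => f (u, p) :=
  hf.cont.comp (continuous_const.prodMk continuous_id)

theorem integrable_pow_mul (hf : RapidDecay f) (u : Sph n) (k : ℕ) :
    Integrable fun p : ℝ => ((p ^ k : ℝ) : ℂ) * f (u, p) := by
  obtain ⟨C, -, hC⟩ := hf.exists_norm_le k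
  have := hf.cont_slice u
  refine (integrable_inv_one_add_sq.const_mul C).mono'
    ((Complex.continuous_ofReal.comp (continuous_pow k)).mul this).aestronglyMeasurable
    (Eventually.of_forall fun p => le_trans ?_ (hC (u, p)))
  rw [norm_mul, Complex.norm_real, norm_pow, Real.norm_eq_abs]
  exact mul_le_mul_of_nonneg_right (abs_pow_le_one_add_sq_pow p k) (norm_nonneg _)

theorem integrable_slice (hf : RapidDecay f) (u : Sph n) : Integrable fun p : ℝ => f (u, p) := by
  simpa using hf.integrable_pow_mul u 0

theorem primitive_sub (hf : RapidDecay f) (u : Sph n) (a b : ℝ) :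
    primitive f (u, b) - primitive f (u, a) = ∫ q in a..b, f (u, q) :=
  intervalIntegral.integral_Iic_sub_Iic (hf.integrable_slice u).integrableOn
    (hf.integrable_slice u).integrableOn

theorem hasDerivAt_primitive (hf : RapidDecay f) (u : Sph n) (p : ℝ) :
    HasDerivAt (fun p => primitive f (u, p)) (f (u, p)) p := by
  have h : (fun p => primitive f (u, p)) =
      fun p => primitive f (u, 0) + ∫ q in (0 : ℝ)..p, f (u, q) := funext fun p => by
    rw [← hf.primitive_sub u 0 p]; ring
  rw [h]
  exact (((hf.cont_slice u).integral_hasStrictDerivAt 0 p).hasDerivAt).const_add _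

theorem continuous_primitive (hf : RapidDecay f) : Continuous (primitive f) := by
  have h : primitive f = fun z => primitive f (z.1, 0) + ∫ q in (0 : ℝ)..z.2, f (z.1, q) :=
    funext fun z => by rw [← hf.primitive_sub z.1 0 z.2]; simp
  rw [h]
  refine Continuous.add ?_ ?_
  · obtain ⟨C, -, hC⟩ := hf.exists_norm_le 0
    refine Continuous.comp (g := fun u => primitive f (u, 0)) ?_ continuous_fst
    change Continuous fun u => ∫ q in Iic (0 : ℝ), f (u, q)
    refine continuous_of_dominated (bound := fun q => C * (1 + q ^ 2)⁻¹)
      (fun u => (hf.cont_slice u).aestronglyMeasurable)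
      (fun u => Eventually.of_forall fun q => by simpa using hC (u, q))
      (integrable_inv_one_add_sq.const_mul C).integrableOn
      (Eventually.of_forall fun q => hf.cont.comp (continuous_id.prodMk continuous_const))
  · refine intervalIntegral.continuous_parametric_intervalIntegral_of_continuous
      (f := fun (z : Sph n × ℝ) q => f (z.1, q)) ?_ continuous_snd
    exact hf.cont.comp ((continuous_fst.comp continuous_fst).prodMk continuous_snd)

/-- A zero integral lets the primitive be computed from whichever end of the line lies on the side
of `p`, so that only points with `q² ≥ p²` contribute. One power of the weight is spent on
convergence, and `π` is the integral of `(1 + q²)⁻¹`. -/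
theorem norm_primitive_le (hf : RapidDecay f) (h0 : ∀ u, ∫ p, f (u, p) = 0) {r : ℕ} {C : ℝ}
    (hC : ∀ z, (1 + z.2 ^ 2) ^ (r + 1) * ‖f z‖ ≤ C) (z : Sph n × ℝ) :
    (1 + z.2 ^ 2) ^ r * ‖primitive f z‖ ≤ Real.pi * C := by
  obtain ⟨u, p⟩ := z
  have hC0 : 0 ≤ C := le_trans (by positivity) (hC (u, p))
  have hset : ∃ s : Set ℝ, MeasurableSet s ∧ (∀ q ∈ s, p ^ 2 ≤ q ^ 2) ∧
      ‖primitive f (u, p)‖ = ‖∫ q in s, f (u, q)‖ := by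
    rcases le_total p 0 with hp | hp
    · refine ⟨Iic p, measurableSet_Iic, fun q hq => ?_, rfl⟩
      have : q ≤ p := hq
      nlinarith
    · refine ⟨Ioi p, measurableSet_Ioi, fun q hq => ?_, ?_⟩
      · have : p < q := hq
        nlinarith
      · have := intervalIntegral.integral_Iic_add_Ioi (b := p)
          (hf.integrable_slice u).integrableOn (hf.integrable_slice u).integrableOn
        rw [h0 u] at this
        rw [show primitive f (u, p) = -∫ q in Ioi p, f (u, q) from eq_neg_of_add_eq_zero_left this,
          norm_neg]
  obtain ⟨s, hs, hsp, e⟩ := hset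
  have hpos : (0 : ℝ) < (1 + p ^ 2) ^ r := by positivity
  have hi : Integrable fun q : ℝ => C * ((1 + p ^ 2) ^ r)⁻¹ * (1 + q ^ 2)⁻¹ :=
    integrable_inv_one_add_sq.const_mul _
  have hb : ‖∫ q in s, f (u, q)‖ ≤ ∫ q in s, C * ((1 + p ^ 2) ^ r)⁻¹ * (1 + q ^ 2)⁻¹ := by
    refine norm_integral_le_of_norm_le hi.integrableOn ?_
    filter_upwards [ae_restrict_mem hs] with q hq
    have h1 := hC (u, q)
    have h2 : (1 + p ^ 2) ^ r ≤ (1 + q ^ 2) ^ r :=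
      pow_le_pow_left₀ (by positivity) (by linarith [hsp q hq]) r
    have hq : (0 : ℝ) < 1 + q ^ 2 := by positivity
    rw [← div_eq_mul_inv, ← div_eq_mul_inv, div_div, le_div_iff₀ (by positivity)]
    refine le_trans ?_ h1
    calc ‖f (u, q)‖ * ((1 + p ^ 2) ^ r * (1 + q ^ 2))
        ≤ ‖f (u, q)‖ * ((1 + q ^ 2) ^ r * (1 + q ^ 2)) := by gcongr
      _ = (1 + q ^ 2) ^ (r + 1) * ‖f (u, q)‖ := by ring
  have hb2 : ∫ q in s, C * ((1 + p ^ 2) ^ r)⁻¹ * (1 + q ^ 2)⁻¹ ≤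
      ∫ q, C * ((1 + p ^ 2) ^ r)⁻¹ * (1 + q ^ 2)⁻¹ :=
    setIntegral_le_integral hi (Eventually.of_forall fun q => by simp only [Pi.zero_apply]; positivity)
  have hb3 : ∫ q : ℝ, C * ((1 + p ^ 2) ^ r)⁻¹ * (1 + q ^ 2)⁻¹ =
      C * ((1 + p ^ 2) ^ r)⁻¹ * Real.pi := by
    rw [integral_const_mul, integral_univ_inv_one_add_sq]
  rw [hb3] at hb2
  rw [e]
  calc (1 + p ^ 2) ^ r * ‖∫ q in s, f (u, q)‖
      ≤ (1 + p ^ 2) ^ r * (C * ((1 + p ^ 2) ^ r)⁻¹ * Real.pi) := by gcongr; exact hb.trans hb2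
    _ = Real.pi * C := by field_simp

theorem primitive (hf : RapidDecay f) (h0 : ∀ u, ∫ p, f (u, p) = 0) : RapidDecay (primitive f) :=
  ⟨hf.continuous_primitive, fun r => by
    obtain ⟨C, hC⟩ := hf.bound (r + 1)
    exact ⟨_, hf.norm_primitive_le h0 hC⟩⟩

theorem integral_pow_mul_deriv {f' : Sph n × ℝ → ℂ} (hf : RapidDecay f) (hf' : RapidDecay f')
    (hd : ∀ u p, HasDerivAt (fun p => f (u, p)) (f' (u, p)) p) (u : Sph n) (k : ℕ) :
    ∫ p : ℝ, ((p ^ (k + 1) : ℝ) : ℂ) * f' (u, p) =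
      -((k + 1) * ∫ p : ℝ, ((p ^ k : ℝ) : ℂ) * f (u, p)) := by
  have hpd : ∀ p : ℝ, HasDerivAt (fun p : ℝ => ((p ^ (k + 1) : ℝ) : ℂ))
      (((k + 1 : ℕ) * p ^ k : ℝ) : ℂ) p := fun p => by
    have := (hasDerivAt_pow (k + 1) p).ofReal_comp
    simpa using this
  rw [integral_mul_deriv_eq_deriv_mul_of_integrable (fun p _ => hpd p) (fun p _ => hd u p)
    (hf'.integrable_pow_mul u (k + 1)) _ (hf.integrable_pow_mul u (k + 1)), ← integral_const_mul]
  · congr 2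
    funext p
    push_cast
    ring
  · refine ((hf.integrable_pow_mul u k).const_mul (k + 1 : ℂ)).congr
      (Eventually.of_forall fun p => ?_)
    simp only [Pi.mul_apply]
    push_cast
    ring

theorem integral_deriv {f' : Sph n × ℝ → ℂ} (hf : RapidDecay f) (hf' : RapidDecay f')
    (hd : ∀ u p, HasDerivAt (fun p => f (u, p)) (f' (u, p)) p) (u : Sph n) :
    ∫ p : ℝ, f' (u, p) = 0 :=
  integral_eq_zero_of_hasDerivAt_of_integrable (fun p => hd u p) (hf'.integrable_slice u)
    (hf.integrable_slice u)

theorem momentFree_deriv {f' : Sph n × ℝ → ℂ} (hf : RapidDecay f) (hf' : RapidDecay f')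
    (hd : ∀ u p, HasDerivAt (fun p => f (u, p)) (f' (u, p)) p) (hm : MomentFree f) :
    MomentFree f' := fun u k => by
  cases k with
  | zero => simpa using hf.integral_deriv hf' hd u
  | succ k => rw [hf.integral_pow_mul_deriv hf' hd u k, hm u k]; simp

theorem integral_eq_zero (hm : MomentFree f) (u : Sph n) : ∫ p, f (u, p) = 0 := by
  simpa using hm u 0

/-- Integration by parts: up to a nonzero factor, the `k`-th moment of the primitive is the `(k +
1)`-st moment of `f`. -/
theorem momentFree_primitive (hf : RapidDecay f) (hm : MomentFree f) :
    MomentFree (LizorkinRadon.primitive f) := fun u k => by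
  have h := (hf.primitive (integral_eq_zero hm)).integral_pow_mul_deriv hf
    hf.hasDerivAt_primitive u k
  rw [hm u (k + 1), eq_comm, neg_eq_zero, mul_eq_zero] at h
  exact h.resolve_left (by exact_mod_cast k.succ_ne_zero)

theorem tendsto_atBot (hf : RapidDecay f) (u : Sph n) :
    Tendsto (fun p => f (u, p)) atBot (𝓝 0) := by
  obtain ⟨C, -, hC⟩ := hf.exists_norm_le 0
  refine squeeze_zero_norm (a := fun p : ℝ => C * (1 + p ^ 2)⁻¹)
    (fun p => by simpa using hC (u, p)) ?_
  have h1 : Tendsto (fun p : ℝ => 1 + p ^ 2) atBot atTop :=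
    tendsto_atTop_add_const_left _ _ <| by
      simpa [Function.comp_def] using
        (tendsto_pow_atTop (α := ℝ) two_ne_zero).comp tendsto_abs_atBot_atTop
  simpa using (tendsto_inv_atTop_zero.comp h1).const_mul C

/-- No constant of integration appears, since `f` tends to `0` at `-∞`. -/
theorem primitive_deriv {f' : Sph n × ℝ → ℂ} (hf : RapidDecay f) (hf' : RapidDecay f')
    (hd : ∀ u p, HasDerivAt (fun p => f (u, p)) (f' (u, p)) p) :
    LizorkinRadon.primitive f' = f := funext fun z => by
  have := integral_Iic_of_hasDerivAt_of_tendsto' (a := z.2) (fun p _ => hd z.1 p)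
    (hf'.integrable_slice z.1).integrableOn (hf.tendsto_atBot z.1)
  rw [sub_zero] at this
  exact this

end RapidDecay

/-- The shift `τ u` does not change the integral of the majorant over a fibre, and the sphere has
finite measure. -/
theorem integrable_prod_of_le {n : ℕ} {G : Sph n × ℝ → ℂ} (hG : Continuous G) {τ : Sph n → ℝ}
    {C : ℝ} (hC : ∀ u p, ‖G (u, p)‖ ≤ C * (1 + (τ u + p) ^ 2)⁻¹) :
    Integrable G ((surf n).prod volume) := by
  have hi : ∀ u, Integrable fun p : ℝ => C * (1 + (τ u + p) ^ 2)⁻¹ := fun u =>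
    (integrable_inv_one_add_sq.comp_add_left (τ u)).const_mul C
  rw [integrable_prod_iff hG.aestronglyMeasurable]
  refine ⟨Eventually.of_forall fun u => (hi u).mono'
    (hG.comp (continuous_const.prodMk continuous_id)).aestronglyMeasurable
    (Eventually.of_forall (hC u)), ?_⟩
  refine (integrable_const (C * Real.pi)).mono'
    hG.aestronglyMeasurable.norm.integral_prod_right' (Eventually.of_forall fun u => ?_)
  rw [Real.norm_of_nonneg (by positivity)]
  calc ∫ p, ‖G (u, p)‖ ≤ ∫ p, C * (1 + (τ u + p) ^ 2)⁻¹ :=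
        integral_mono_of_nonneg (Eventually.of_forall fun p => norm_nonneg _) (hi u)
          (Eventually.of_forall (hC u))
    _ = C * Real.pi := by
        rw [integral_const_mul, integral_add_left_eq_self (fun p : ℝ => (1 + p ^ 2)⁻¹),
          integral_univ_inv_one_add_sq]

theorem RapidDecay.integrable_shift {n : ℕ} {f : Sph n × ℝ → ℂ} (hf : RapidDecay f)
    {c : Sph n → ℂ} (hc : Continuous c) {τ : Sph n → ℝ} (hτ : Continuous τ) :
    Integrable (fun z : Sph n × ℝ => c z.1 * f (z.1, τ z.1 + z.2)) ((surf n).prod volume) := by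
  obtain ⟨C, hC0, hC⟩ := hf.exists_norm_le 0
  obtain ⟨B, hB⟩ := isCompact_univ.exists_bound_of_continuousOn hc.continuousOn
  refine integrable_prod_of_le (τ := τ) (C := B * C) ?_ fun u p => ?_
  · have := hf.cont
    fun_prop
  · have h1 := hC (u, τ u + p)
    have h2 := hB u trivial
    rw [norm_mul, mul_assoc]
    simp only [pow_zero, one_mul] at h1
    exact mul_le_mul h2 h1 (norm_nonneg _) ((norm_nonneg _).trans h2)

/-- Integrating the primitive over the sphere along the hyperplanes is integrating over the
offset. -/
theorem RapidDecay.integral_primitive_shift {n : ℕ} {f : Sph n × ℝ → ℂ} (hf : RapidDecay f)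
    {c : Sph n → ℂ} (hc : Continuous c) {τ : Sph n → ℝ} (hτ : Continuous τ) (b : ℝ) :
    IntegrableOn (fun t => ∫ u, c u * f (u, τ u + t) ∂(surf n)) (Iic b) ∧
    ∫ u, c u * LizorkinRadon.primitive f (u, τ u + b) ∂(surf n) =
      ∫ t in Iic b, ∫ u, c u * f (u, τ u + t) ∂(surf n) := by
  have hi : Integrable (fun z : Sph n × ℝ => c z.1 * f (z.1, τ z.1 + z.2))
      ((surf n).prod (volume.restrict (Iic b))) :=
    (hf.integrable_shift hc hτ).mono_measure (Measure.prod_mono le_rfl Measure.restrict_le_self)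
  refine ⟨hi.integral_prod_right, ?_⟩
  rw [← integral_integral_swap hi]
  refine integral_congr_ae (Eventually.of_forall fun u => ?_)
  simp only [integral_const_mul]
  congr 1
  -- Translation by `τ u` makes the domain of integration `Iic b` independent of `u`, which is what
  -- allows the interchange of integrals.
  have := (measurePreserving_add_left (volume : Measure ℝ) (τ u)).setIntegral_preimage_emb
    (measurableEmbedding_addLeft (τ u)) (fun q => f (u, q)) (Iic (τ u + b))
  rw [LizorkinRadon.primitive, ← this]
  congr 2
  ext t
  simp

namespace RapidDecay

variable {n : ℕ} {f : Sph n × ℝ → ℂ}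

theorem pow_mul (hf : RapidDecay f) (k : ℕ) :
    RapidDecay fun z : Sph n × ℝ => ((z.2 ^ k : ℝ) : ℂ) * f z := by
  refine ⟨(Complex.continuous_ofReal.comp (continuous_snd.pow k)).mul hf.cont, fun r => ?_⟩
  obtain ⟨C, hC⟩ := hf.bound (r + k)
  refine ⟨C, fun z => le_trans ?_ (hC z)⟩
  rw [norm_mul, Complex.norm_real, norm_pow, Real.norm_eq_abs, pow_add, mul_assoc]
  exact mul_le_mul_of_nonneg_left
    (mul_le_mul_of_nonneg_right (abs_pow_le_one_add_sq_pow _ _) (norm_nonneg _)) (by positivity)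

theorem conj (hf : RapidDecay f) : RapidDecay fun z => (starRingEnd ℂ) (f z) :=
  ⟨Complex.continuous_conj.comp hf.cont, fun r => by
    obtain ⟨C, hC⟩ := hf.bound r
    exact ⟨C, fun z => by simpa using hC z⟩⟩

theorem continuous_integral (hf : RapidDecay f) : Continuous fun u => ∫ p, f (u, p) := by
  obtain ⟨C, -, hC⟩ := hf.exists_norm_le 0
  exact continuous_of_dominated (bound := fun q => C * (1 + q ^ 2)⁻¹)
    (fun u => (hf.cont_slice u).aestronglyMeasurable)
    (fun u => Eventually.of_forall fun q => by simpa using hC (u, q))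
    (integrable_inv_one_add_sq.const_mul C)
    (Eventually.of_forall fun q => hf.cont.comp (continuous_id.prodMk continuous_const))

theorem integral_mul_integral (hf : RapidDecay f) {c : Sph n → ℂ} (hc : Continuous c) :
    ∫ u, (c u * ∫ p, f (u, p)) ∂(surf n) = ∫ p, ∫ u, c u * f (u, p) ∂(surf n) := by
  have hi := hf.integrable_shift hc (τ := fun _ => 0) continuous_const
  simp only [zero_add] at hi
  rw [← integral_integral_swap hi]
  simp only [integral_const_mul]

end RapidDecay

/-! ### Vanishing moments and the Laplace–Beltrami operator -/

theorem rayExt_smul {n : ℕ} (f : Sph n → ℂ) {t : ℝ} (ht : 0 < t) (y : Euc n) :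
    rayExt f (t • y) = rayExt f y := by
  by_cases hy : y = 0
  · simp [hy]
  · have h : t • y ≠ 0 := by simp [ht.ne', hy]
    simp only [rayExt, hy, h, dite_false]
    congr 2
    rw [norm_smul, Real.norm_of_nonneg ht.le, mul_inv, smul_smul]
    congr 1
    field_simp

variable {n : ℕ} [Fact (2 ≤ n)]

theorem contDiffAt_rayExt_slice {f : Sph n × ℝ → ℂ} (h : ContMDiff (cylModel n) 𝓘(ℝ, ℂ) ∞ f)
    (p : ℝ) (y : Euc n) (hy : y ≠ 0) : ContDiffAt ℝ ∞ (rayExt fun u => f (u, p)) y :=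
  (contDiffAt_rayExt h (y, p) hy).comp y (contDiffAt_id.prodMk contDiffAt_const)

/-- The Laplace–Beltrami operator preserves the vanishing of the moments. -/
theorem momentFree_lapFun {f : Sph n × ℝ → ℂ} (h : ContMDiff (cylModel n) 𝓘(ℝ, ℂ) ∞ f)
    (hf : RapidDecay f) (hl : RapidDecay (lapFun f)) (hm : MomentFree f) :
    MomentFree (lapFun f) := by
  intro u₀ k
  set M : Sph n → ℂ := fun u => ∫ p : ℝ, ((p ^ k : ℝ) : ℂ) * lapFun f (u, p) with hM
  have hMc : Continuous M := (hl.pow_mul k).continuous_integral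
  -- The moment `M` of `Δᵤ f` is orthogonal to every smooth `H`: by Fubini and symmetry the
  -- Laplacian moves onto `H`, leaving a moment of `f`. Only continuity of `M` is used.
  have test : ∀ H : Euc n → ℂ, (∀ y ≠ 0, ContDiffAt ℝ ∞ H y) →
      (∀ t : ℝ, 0 < t → ∀ y, H (t • y) = H y) → ∫ u : Sph n, H u * M u ∂(surf n) = 0 := by
    intro H hH hH0
    have hHc : Continuous fun u : Sph n => H u :=
      continuous_sphere_of_ne_zero fun y hy => (hH y hy).continuousAt
    have hLc : Continuous fun u : Sph n => Laplacian.laplacian H u := by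
      simp only [laplacian_eq_sum_fderiv]
      refine continuous_finsetSum _ fun i _ => continuous_sphere_of_ne_zero
        (f := fun y => fderiv ℝ (fderiv ℝ H) y _ _) fun y hy => ?_
      have hd : ContDiffAt ℝ ∞ (fderiv ℝ (fderiv ℝ H)) y :=
        ((hH y hy).fderiv_right (m := ∞) (by simp)).fderiv_right (by simp)
      exact (hd.continuousAt.clm_apply continuousAt_const).clm_apply continuousAt_const
    have h1 := (hl.pow_mul k).integral_mul_integral hHc
    have h2 := (hf.pow_mul k).integral_mul_integral hLc
    rw [h1]
    simp only [hm _ k, mul_zero, integral_zero] at h2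
    rw [h2]
    refine integral_congr_ae (Eventually.of_forall fun p => ?_)
    have h3 := integral_laplacian_mul_comm (contDiffAt_rayExt_slice h p) hH
      (fun t ht y => rayExt_smul _ ht y) hH0
    simp only [rayExt_coe] at h3
    have e1 : ∀ u : Sph n, H u * (((p ^ k : ℝ) : ℂ) * lapFun f (u, p)) =
        ((p ^ k : ℝ) : ℂ) * (Laplacian.laplacian (rayExt fun u => f (u, p)) (u : Euc n) * H u) :=
      fun u => by simp only [lapFun, sphereLaplacian]; ring
    have e2 : ∀ u : Sph n, Laplacian.laplacian H u * (((p ^ k : ℝ) : ℂ) * f (u, p)) =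
        ((p ^ k : ℝ) : ℂ) * (f (u, p) * Laplacian.laplacian H u) :=
      fun u => by ring
    simp only [e1, e2, integral_const_mul, h3]
  -- Instead of a density argument, the test functions are the conjugates of the slices of `Δᵤ f`.
  -- Integrating them over `q` against `q ^ k` rebuilds the conjugate of `M`, so that `∫ ‖M‖² = 0`.
  have hq : ∀ q : ℝ, ∫ u : Sph n, M u * (starRingEnd ℂ) (lapFun f (u, q)) ∂(surf n) = 0 := by
    intro q
    have := test (fun y => (starRingEnd ℂ) (rayExt (fun u => lapFun f (u, q)) y))
      (fun y hy => Complex.conjCLE.contDiff.contDiffAt.comp y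
        (contDiffAt_rayExt_slice (contMDiff_lapFun h) q y hy))
      (fun t ht y => by rw [rayExt_smul _ ht])
    simp only [rayExt_coe] at this
    rw [← this]
    simp only [mul_comm]
  have hsq : ∫ u : Sph n, M u * (starRingEnd ℂ) (M u) ∂(surf n) = 0 := by
    have h1 := (hl.pow_mul k).conj.integral_mul_integral hMc
    simp only [integral_conj] at h1
    rw [h1]
    refine integral_eq_zero_of_ae (Eventually.of_forall fun q => ?_)
    have e : ∀ u, M u * (starRingEnd ℂ) (((q ^ k : ℝ) : ℂ) * lapFun f (u, q)) =
        ((q ^ k : ℝ) : ℂ) * (M u * (starRingEnd ℂ) (lapFun f (u, q))) := fun u => by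
      simp only [map_mul, Complex.conj_ofReal]; ring
    simp only [e, integral_const_mul, hq q, mul_zero, Pi.zero_apply]
  have hn : ∫ u : Sph n, ‖M u‖ ^ 2 ∂(surf n) = 0 := by
    simp only [Complex.mul_conj, Complex.normSq_eq_norm_sq] at hsq
    rw [integral_complex_ofReal] at hsq
    exact_mod_cast hsq
  by_contra hne
  have hpos := Continuous.integral_pos_of_hasCompactSupport_nonneg_nonzero (μ := surf n)
    (f := fun u => ‖M u‖ ^ 2) (hMc.norm.pow 2) (HasCompactSupport.of_compactSpace _)
    (fun u => by simp only [Pi.zero_apply]; positivity) (x := u₀)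
    (by simpa [hM] using hne)
  exact hpos.ne' hn

/-! ### The hyperplane identity with polynomial weights -/

theorem continuous_inner_sphere {n : ℕ} (x : Euc n) :
    Continuous fun u : Sph n => inner ℝ x (u : Euc n) :=
  continuous_const.inner continuous_subtype_val

theorem continuous_eval_inner {n : ℕ} (x : Euc n) (η : Polynomial ℝ) :
    Continuous fun u : Sph n => η.eval (inner ℝ x (u : Euc n)) :=
  η.continuous.comp (continuous_inner_sphere x)

theorem integral_add_four {α : Type*} [MeasurableSpace α] {μ : Measure α} {a b c d : α → ℂ}
    (ha : Integrable a μ) (hb : Integrable b μ) (hc : Integrable c μ) (hd : Integrable d μ) :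
    ∫ t, a t ∂μ + ∫ t, b t ∂μ + ∫ t, c t ∂μ + ∫ t, d t ∂μ = ∫ t, (a t + b t + c t + d t) ∂μ := by
  have h1 := integral_add' ((ha.add hb).add hc) hd
  rw [integral_add' (ha.add hb) hc, integral_add' ha hb] at h1
  exact h1.symm

/-- The coefficient of `∂²f` in the hyperplane identity. -/
def coeffTwo {n : ℕ} (x : Euc n) (η : Polynomial ℝ) (u : Sph n) : ℝ :=
  -(‖x‖ ^ 2 - inner ℝ x (u : Euc n) ^ 2) * η.eval (inner ℝ x (u : Euc n))

/-- The coefficient of `∂f` in the hyperplane identity. -/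
def coeffOne {n : ℕ} (x : Euc n) (η : Polynomial ℝ) (u : Sph n) : ℝ :=
  -(2 * (‖x‖ ^ 2 - inner ℝ x (u : Euc n) ^ 2)) * η.derivative.eval (inner ℝ x (u : Euc n)) +
    (n - 1) * inner ℝ x (u : Euc n) * η.eval (inner ℝ x (u : Euc n))

/-- The coefficient of `f` in the hyperplane identity. -/
def coeffZero {n : ℕ} (x : Euc n) (η : Polynomial ℝ) (u : Sph n) : ℝ :=
  -(‖x‖ ^ 2 - inner ℝ x (u : Euc n) ^ 2) * η.derivative.derivative.eval (inner ℝ x (u : Euc n)) +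
    (n - 1) * inner ℝ x (u : Euc n) * η.derivative.eval (inner ℝ x (u : Euc n))

theorem continuous_coeffTwo {n : ℕ} (x : Euc n) (η : Polynomial ℝ) :
    Continuous (coeffTwo x η) :=
  (continuous_const.sub ((continuous_inner_sphere x).pow 2)).neg.mul (continuous_eval_inner x η)

theorem continuous_coeffOne {n : ℕ} (x : Euc n) (η : Polynomial ℝ) :
    Continuous (coeffOne x η) :=
  ((continuous_const.mul (continuous_const.sub ((continuous_inner_sphere x).pow 2))).neg.mul
    (continuous_eval_inner x η.derivative)).add
    ((continuous_const.mul (continuous_inner_sphere x)).mul (continuous_eval_inner x η))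

theorem continuous_coeffZero {n : ℕ} (x : Euc n) (η : Polynomial ℝ) :
    Continuous (coeffZero x η) :=
  ((continuous_const.sub ((continuous_inner_sphere x).pow 2)).neg.mul
    (continuous_eval_inner x η.derivative.derivative)).add
    ((continuous_const.mul (continuous_inner_sphere x)).mul
      (continuous_eval_inner x η.derivative))

/-- The identity between the integrals of `f₀ = ∂²f`, `f₁ = ∂f`, `f₂ = f` and `g = Δ_u f` along the
hyperplane sections `s = ⟪x, u⟫`, with polynomial weights. -/
def HyperplaneIdentity {n : ℕ} (f₀ f₁ f₂ g : Sph n × ℝ → ℂ) : Prop :=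
  ∀ (x : Euc n) (b : ℝ) (η : Polynomial ℝ),
    ∫ u : Sph n, ((η.eval (inner ℝ x (u : Euc n)) : ℝ) : ℂ) *
        g (u, inner ℝ x (u : Euc n) + b) ∂(surf n)
    + ∫ u : Sph n, (coeffTwo x η u : ℂ) * f₀ (u, inner ℝ x (u : Euc n) + b) ∂(surf n)
    + ∫ u : Sph n, (coeffOne x η u : ℂ) * f₁ (u, inner ℝ x (u : Euc n) + b) ∂(surf n)
    + ∫ u : Sph n, (coeffZero x η u : ℂ) * f₂ (u, inner ℝ x (u : Euc n) + b) ∂(surf n) = 0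

/-- The coefficients do not involve the offset `b`, so integrating the identity over all offsets up
to `b` replaces each function by its primitive. This is why the identity carries an offset, and it
spares any proof that primitives are smooth in `u`. -/
theorem HyperplaneIdentity.primitive {n : ℕ} {f₀ f₁ f₂ g : Sph n × ℝ → ℂ}
    (h : HyperplaneIdentity f₀ f₁ f₂ g) (h₀ : RapidDecay f₀) (h₁ : RapidDecay f₁)
    (h₂ : RapidDecay f₂) (hg : RapidDecay g) :
    HyperplaneIdentity (primitive f₀) (primitive f₁) (primitive f₂) (primitive g) := by
  intro x b η
  have hs := continuous_inner_sphere x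
  obtain ⟨ig, eg⟩ := hg.integral_primitive_shift
    (c := fun u => ((η.eval (inner ℝ x (u : Euc n)) : ℝ) : ℂ))
    (Complex.continuous_ofReal.comp (continuous_eval_inner x η)) hs b
  obtain ⟨i0, e0⟩ := h₀.integral_primitive_shift (c := fun u => (coeffTwo x η u : ℂ))
    (Complex.continuous_ofReal.comp (continuous_coeffTwo x η)) hs b
  obtain ⟨i1, e1⟩ := h₁.integral_primitive_shift (c := fun u => (coeffOne x η u : ℂ))
    (Complex.continuous_ofReal.comp (continuous_coeffOne x η)) hs b
  obtain ⟨i2, e2⟩ := h₂.integral_primitive_shift (c := fun u => (coeffZero x η u : ℂ))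
    (Complex.continuous_ofReal.comp (continuous_coeffZero x η)) hs b
  rw [eg, e0, e1, e2, integral_add_four ig i0 i1 i2]
  exact integral_eq_zero_of_ae (Eventually.of_forall fun t => h x t η)

/-- This is `integral_laplacian_hyperplane` for `P (u, s) = η (s) f (u, s + b)`. The Leibniz rule in
`s` distributes the derivatives over `η` and `f` and yields the three coefficients. -/
theorem hyperplaneIdentity_lapFun {f : Sph n × ℝ → ℂ}
    (h : ContMDiff (cylModel n) 𝓘(ℝ, ℂ) ∞ f) :
    HyperplaneIdentity (derivFun (derivFun f)) (derivFun f) f (lapFun f) := by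
  intro x b η
  have hs := continuous_inner_sphere x
  have hsb : Continuous fun u : Sph n => (u, inner ℝ x (u : Euc n) + b) :=
    continuous_id.prodMk (hs.add continuous_const)
  have cf : ∀ {g : Sph n × ℝ → ℂ}, ContMDiff (cylModel n) 𝓘(ℝ, ℂ) ∞ g →
      ∀ c : Sph n → ℝ, Continuous c →
      Integrable (fun u : Sph n => (c u : ℂ) * g (u, inner ℝ x (u : Euc n) + b)) (surf n) :=
    fun hg c hc => integrable_sphere ((Complex.continuous_ofReal.comp hc).mul
      (hg.continuous.comp hsb))
  have h1 := contMDiff_derivFun h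
  have h2 := contMDiff_derivFun h1
  have i3 := cf (contMDiff_lapFun h) _ (continuous_eval_inner x η)
  have i0 := cf h2 _ (continuous_coeffTwo x η)
  have i1 := cf h1 _ (continuous_coeffOne x η)
  have i2 := cf h _ (continuous_coeffZero x η)
  rw [integral_add_four i3 i0 i1 i2]
  have hη : ∀ (η : Polynomial ℝ) (s : ℝ), HasDerivAt (fun s => ((η.eval s : ℝ) : ℂ))
      ((η.derivative.eval s : ℝ) : ℂ) s := fun η s => (η.hasDerivAt s).ofReal_comp
  have hd : ∀ {g : Sph n × ℝ → ℂ}, ContMDiff (cylModel n) 𝓘(ℝ, ℂ) ∞ g → ∀ (u : Sph n) (s : ℝ),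
      HasDerivAt (fun s => g (u, s + b)) (derivFun g (u, s + b)) s := fun hg u s =>
    HasDerivAt.comp_add_const s b (differentiableAt_slice hg (u, s + b)).hasDerivAt
  set P : Euc n × ℝ → ℂ := fun z =>
    ((η.eval z.2 : ℝ) : ℂ) • rayExt (fun u => f (u, z.2 + b)) z.1 with hP
  have hPs : ∀ z : Euc n × ℝ, z.1 ≠ 0 → ContDiffAt ℝ ∞ P z := fun z hz => by
    have a1 : ContDiff ℝ ∞ fun z : Euc n × ℝ => ((η.eval z.2 : ℝ) : ℂ) :=
      Complex.ofRealCLM.contDiff.comp (ContDiff.comp (g := fun s : ℝ => η.eval s)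
        (by simpa using η.contDiff_aeval (R := ℝ) (𝕜 := ℝ) ∞) contDiff_snd)
    have a2 : ContDiffAt ℝ ∞ (fun z : Euc n × ℝ => rayExt (fun u => f (u, z.2 + b)) z.1) z :=
      (contDiffAt_rayExt h (z.1, z.2 + b) hz).comp z
        (contDiffAt_fst.prodMk (contDiffAt_snd.add contDiffAt_const))
    exact a1.contDiffAt.smul a2
  have key := integral_laplacian_hyperplane hPs
    (fun t ht y s => by simp only [hP, rayExt_smul _ ht]) x
  rw [← key]
  refine integral_congr_ae (Eventually.of_forall fun u => ?_)
  have hPu : (fun s => P ((u : Euc n), s)) = fun s => ((η.eval s : ℝ) : ℂ) * f (u, s + b) :=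
    funext fun s => by simp only [hP, rayExt_coe, smul_eq_mul]
  have hP1 : deriv (fun s => P ((u : Euc n), s)) = fun s =>
      ((η.derivative.eval s : ℝ) : ℂ) * f (u, s + b) +
        ((η.eval s : ℝ) : ℂ) * derivFun f (u, s + b) := funext fun s => by
    rw [hPu]
    exact ((hη η s).mul (hd h u s)).deriv
  have hP2 : ∀ s, deriv (deriv fun s => P ((u : Euc n), s)) s =
      (((η.derivative.derivative.eval s : ℝ) : ℂ) * f (u, s + b) +
        ((η.derivative.eval s : ℝ) : ℂ) * derivFun f (u, s + b)) +
      (((η.derivative.eval s : ℝ) : ℂ) * derivFun f (u, s + b) +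
        ((η.eval s : ℝ) : ℂ) * derivFun (derivFun f) (u, s + b)) := fun s => by
    rw [hP1]
    exact (((hη η.derivative s).mul (hd h u s)).add ((hη η s).mul (hd h1 u s))).deriv
  have hL : ∀ s, Laplacian.laplacian (fun y => P (y, s)) (u : Euc n) =
      ((η.eval s : ℝ) : ℂ) * lapFun f (u, s + b) := fun s => by
    have := InnerProductSpace.laplacian_smul ((η.eval s : ℝ) : ℂ)
      ((contDiffAt_slice h (u, s + b)).of_le (m := 2) (WithTop.coe_le_coe.2 le_top))
    exact this
  simp only [hL, hP2, fun s => congrFun hP1 s, coeffTwo, coeffOne, coeffZero]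
  push_cast
  ring

/-! ### Families of test functions controlled by continuous seminorms -/

/-- The family of functions `F` is dominated by a continuous seminorm. -/
def Dominated {V ι : Type*} [AddCommGroup V] [Module ℂ V] [TopologicalSpace V] (F : V → ι → ℝ) :
    Prop :=
  ∃ q : Seminorm ℂ V, Continuous q ∧ ∀ v i, F v i ≤ q v

namespace Dominated

variable {V ι : Type*} [AddCommGroup V] [Module ℂ V] [TopologicalSpace V] {F G : V → ι → ℝ}

theorem mono (hG : Dominated G) (h : ∀ v i, F v i ≤ G v i) : Dominated F :=
  let ⟨q, hq, hb⟩ := hG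
  ⟨q, hq, fun v i => (h v i).trans (hb v i)⟩

theorem zero : Dominated fun (_ : V) (_ : ι) => (0 : ℝ) :=
  ⟨0, continuous_const, fun _ _ => le_rfl⟩

theorem add (hF : Dominated F) (hG : Dominated G) : Dominated fun v i => F v i + G v i :=
  let ⟨q, hq, hb⟩ := hF
  let ⟨q', hq', hb'⟩ := hG
  ⟨q + q', hq.add hq', fun v i => add_le_add (hb v i) (hb' v i)⟩

theorem const_mul (hF : Dominated F) {c : ℝ} (hc : 0 ≤ c) : Dominated fun v i => c * F v i := by
  obtain ⟨q, hq, hb⟩ := hF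
  lift c to NNReal using hc
  exact ⟨c • q, hq.const_smul c, fun v i => mul_le_mul_of_nonneg_left (hb v i) c.2⟩

end Dominated

variable {n : ℕ} [Fact (2 ≤ n)]

/-- Functions on the cylinder which depend on `ϱ ∈ 𝓢₀`, with rapid decay controlled by `ϱ` and
vanishing moments. -/
structure TestFamily (f : ↥(SphereLizorkin n) → Sph n × ℝ → ℂ) : Prop where
  rapid : ∀ ϱ, RapidDecay (f ϱ)
  dominated : ∀ r : ℕ, Dominated fun ϱ (z : Sph n × ℝ) => (1 + z.2 ^ 2) ^ r * ‖f ϱ z‖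
  momentFree : ∀ ϱ, MomentFree (f ϱ)

theorem TestFamily.primitive {f : ↥(SphereLizorkin n) → Sph n × ℝ → ℂ} (hf : TestFamily f) :
    TestFamily fun ϱ => primitive (f ϱ) where
  rapid ϱ := (hf.rapid ϱ).primitive (RapidDecay.integral_eq_zero (hf.momentFree ϱ))
  dominated r := by
    obtain ⟨q, hq, hb⟩ := hf.dominated (r + 1)
    have h : Dominated fun (ϱ : ↥(SphereLizorkin n)) (_ : Sph n × ℝ) => q ϱ :=
      ⟨q, hq, fun _ _ => le_rfl⟩
    exact (h.const_mul Real.pi_nonneg).mono fun ϱ z => (hf.rapid ϱ).norm_primitive_le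
      (RapidDecay.integral_eq_zero (hf.momentFree ϱ)) (hb ϱ) z
  momentFree ϱ := (hf.rapid ϱ).momentFree_primitive (hf.momentFree ϱ)

/-- `∂ₚᵐ Δᵤᵏ ϱ`. -/
def jet (k m : ℕ) (ϱ : ↥(SphereLizorkin n)) : Sph n × ℝ → ℂ :=
  ((derivP n ^ m) ((lapU n ^ k) ϱ.1.1)).1

theorem contMDiff_jet (k m : ℕ) (ϱ : ↥(SphereLizorkin n)) :
    ContMDiff (cylModel n) 𝓘(ℝ, ℂ) ∞ (jet k m ϱ) :=
  ((derivP n ^ m) ((lapU n ^ k) ϱ.1.1)).2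

theorem derivFun_jet (k m : ℕ) (ϱ : ↥(SphereLizorkin n)) :
    derivFun (jet k m ϱ) = jet k (m + 1) ϱ := by
  simp only [jet, pow_succ', Module.End.mul_apply]
  rfl

theorem lapFun_jet (k : ℕ) (ϱ : ↥(SphereLizorkin n)) :
    lapFun (jet k 0 ϱ) = jet (k + 1) 0 ϱ := by
  simp only [jet, pow_succ', pow_zero, Module.End.mul_apply]
  rfl

theorem hasDerivAt_jet (k m : ℕ) (ϱ : ↥(SphereLizorkin n)) (u : Sph n) (p : ℝ) :
    HasDerivAt (fun p => jet k m ϱ (u, p)) (jet k (m + 1) ϱ (u, p)) p := by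
  rw [← derivFun_jet]
  exact (differentiableAt_slice (contMDiff_jet k m ϱ) (u, p)).hasDerivAt

/-- The index is `2 * r` because the seminorms carry the weight `(1 + p²) ^ (r / 2)`. -/
theorem dominated_jet (k m r : ℕ) :
    Dominated fun (ϱ : ↥(SphereLizorkin n)) (z : Sph n × ℝ) => (1 + z.2 ^ 2) ^ r * ‖jet k m ϱ z‖ := by
  refine ⟨(SphereSchwartz.seminormFamily n (2 * r, m, k)).comp (SphereLizorkin n).subtype,
    ((SphereSchwartz.withSeminorms n).continuous_seminorm _).comp continuous_subtype_val,
    fun ϱ z => ?_⟩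
  have h := le_ciSup (ϱ.1.2 (2 * r) m k) z
  refine le_trans (le_of_eq ?_) h
  simp only [weighted, LinearMap.coe_mk, AddHom.coe_mk, norm_mul, Complex.norm_real]
  rw [Real.norm_of_nonneg (by positivity)]
  congr 1
  rw [show (((2 * r : ℕ) : ℝ) / 2) = (r : ℝ) by push_cast; ring, Real.rpow_natCast]

theorem rapidDecay_jet (k m : ℕ) (ϱ : ↥(SphereLizorkin n)) : RapidDecay (jet k m ϱ) :=
  ⟨(contMDiff_jet k m ϱ).continuous, fun r =>
    let ⟨q, _, hb⟩ := dominated_jet (n := n) k m r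
    ⟨q ϱ, hb ϱ⟩⟩

theorem momentFree_jet (k m : ℕ) (ϱ : ↥(SphereLizorkin n)) : MomentFree (jet k m ϱ) := by
  induction m with
  | zero =>
    induction k with
    | zero => exact fun u k => ϱ.2 u k
    | succ k ih =>
      rw [← lapFun_jet]
      refine momentFree_lapFun (contMDiff_jet k 0 ϱ) (rapidDecay_jet k 0 ϱ) ?_ ih
      rw [lapFun_jet]
      exact rapidDecay_jet (k + 1) 0 ϱ
  | succ m ih =>
    exact (rapidDecay_jet k m ϱ).momentFree_deriv (rapidDecay_jet k (m + 1) ϱ)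
      (hasDerivAt_jet k m ϱ) ih

theorem testFamily_jet (k m : ℕ) : TestFamily (jet (n := n) k m) :=
  ⟨rapidDecay_jet k m, dominated_jet k m, momentFree_jet k m⟩

theorem primitive_jet (k m : ℕ) (ϱ : ↥(SphereLizorkin n)) :
    primitive (jet k (m + 1) ϱ) = jet k m ϱ :=
  (rapidDecay_jet k m ϱ).primitive_deriv (rapidDecay_jet k (m + 1) ϱ) (hasDerivAt_jet k m ϱ)

theorem testFamily_iterate_primitive {f : ↥(SphereLizorkin n) → Sph n × ℝ → ℂ} (hf : TestFamily f)
    (m : ℕ) : TestFamily fun ϱ => primitive^[m] (f ϱ) := by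
  induction m with
  | zero => exact hf
  | succ m ih => simpa only [Function.iterate_succ_apply'] using ih.primitive

/-- The `m`-fold primitive of `Δᵤᵏ ϱ`. -/
def primJet (m k : ℕ) (ϱ : ↥(SphereLizorkin n)) : Sph n × ℝ → ℂ := primitive^[m] (jet k 0 ϱ)

theorem testFamily_primJet (m k : ℕ) : TestFamily (primJet (n := n) m k) :=
  testFamily_iterate_primitive (testFamily_jet k 0) m

theorem hyperplaneIdentity_primJet (m k : ℕ) (ϱ : ↥(SphereLizorkin n)) :
    HyperplaneIdentity (primJet m k ϱ) (primJet (m + 1) k ϱ) (primJet (m + 2) k ϱ)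
      (primJet (m + 2) (k + 1) ϱ) := by
  have key : ∀ j, HyperplaneIdentity (primitive^[j] (jet k 2 ϱ)) (primitive^[j] (jet k 1 ϱ))
      (primitive^[j] (jet k 0 ϱ)) (primitive^[j] (jet (k + 1) 0 ϱ)) := by
    intro j
    induction j with
    | zero =>
      have := hyperplaneIdentity_lapFun (contMDiff_jet k 0 ϱ)
      rwa [derivFun_jet, derivFun_jet, lapFun_jet] at this
    | succ j ih =>
      simp only [Function.iterate_succ_apply']
      exact ih.primitive ((testFamily_iterate_primitive (testFamily_jet k 2) j).rapid ϱ)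
        ((testFamily_iterate_primitive (testFamily_jet k 1) j).rapid ϱ)
        ((testFamily_iterate_primitive (testFamily_jet k 0) j).rapid ϱ)
        ((testFamily_iterate_primitive (testFamily_jet (k + 1) 0) j).rapid ϱ)
  -- Of the `m + 2` primitives, two undo `∂ₚ²` in the first function and one undoes `∂ₚ` in the
  -- second.
  have h := key (m + 2)
  rw [Function.iterate_succ_apply _ _ (jet k 2 ϱ), Function.iterate_succ_apply _ _
    (primitive (jet k 2 ϱ)), Function.iterate_succ_apply _ _ (jet k 1 ϱ)] at h
  simp only [primitive_jet] at h
  exact h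

/-! ### Rapid decay of the dual Radon transform -/

/-- The dual Radon transform of `f` with the weight `η (⟪x, u⟫)`. -/
def weightedDual {n : ℕ} (f : Sph n × ℝ → ℂ) (η : Polynomial ℝ) (x : Euc n) : ℂ :=
  ∫ u : Sph n, ((η.eval (inner ℝ x (u : Euc n)) : ℝ) : ℂ) * f (u, inner ℝ x (u : Euc n)) ∂(surf n)

theorem integrable_weightedDual {n : ℕ} {f : Sph n × ℝ → ℂ} (hf : Continuous f) (η : Polynomial ℝ)
    (x : Euc n) : Integrable (fun u : Sph n =>
      ((η.eval (inner ℝ x (u : Euc n)) : ℝ) : ℂ) * f (u, inner ℝ x (u : Euc n))) (surf n) :=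
  integrable_sphere ((Complex.continuous_ofReal.comp (continuous_eval_inner x η)).mul
    (hf.comp (continuous_id.prodMk (continuous_inner_sphere x))))

theorem weightedDual_add {n : ℕ} {f : Sph n × ℝ → ℂ} (hf : Continuous f) (η θ : Polynomial ℝ)
    (x : Euc n) : weightedDual f (η + θ) x = weightedDual f η x + weightedDual f θ x := by
  simp only [weightedDual, Polynomial.eval_add, Complex.ofReal_add, add_mul]
  exact integral_add (integrable_weightedDual hf η x) (integrable_weightedDual hf θ x)

theorem weightedDual_C_mul {n : ℕ} (f : Sph n × ℝ → ℂ) (c : ℝ) (η : Polynomial ℝ) (x : Euc n) :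
    weightedDual f (Polynomial.C c * η) x = c * weightedDual f η x := by
  simp only [weightedDual, Polynomial.eval_mul, Polynomial.eval_C, Complex.ofReal_mul, mul_assoc,
    integral_const_mul]

open Polynomial in
-- The identity at offset `0`, solved for its leading term. The terms still multiplied by `‖x‖ ^ 2`
-- involve only derivatives of `η`, hence polynomials of lower degree; all others have lost this
-- factor.
theorem HyperplaneIdentity.sq_mul_weightedDual {n : ℕ} {f₀ f₁ f₂ g : Sph n × ℝ → ℂ}
    (h : HyperplaneIdentity f₀ f₁ f₂ g) (h₀ : Continuous f₀) (h₁ : Continuous f₁)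
    (h₂ : Continuous f₂) (η : Polynomial ℝ) (x : Euc n) :
    ((‖x‖ ^ 2 : ℝ) : ℂ) * weightedDual f₀ η x = weightedDual g η x + weightedDual f₀ (X ^ 2 * η) x
      + weightedDual f₁ (C 2 * (X ^ 2 * derivative η) + C (n - 1 : ℝ) * (X * η)) x
      + weightedDual f₂ (X ^ 2 * derivative (derivative η) + C (n - 1 : ℝ) * (X * derivative η)) x
      - 2 * (((‖x‖ ^ 2 : ℝ) : ℂ) * weightedDual f₁ (derivative η) x)
      - ((‖x‖ ^ 2 : ℝ) : ℂ) * weightedDual f₂ (derivative (derivative η)) x := by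
  have h := h x 0 η
  simp only [add_zero] at h
  have e0 : ∀ u, coeffTwo x η u =
      (C (-‖x‖ ^ 2) * η + X ^ 2 * η).eval (inner ℝ x (u : Euc n)) := fun u => by
    simp [coeffTwo]; ring
  have e1 : ∀ u, coeffOne x η u = (C (-(2 * ‖x‖ ^ 2)) * derivative η +
      (C 2 * (X ^ 2 * derivative η) + C (n - 1 : ℝ) * (X * η))).eval (inner ℝ x (u : Euc n)) :=
    fun u => by simp [coeffOne]; ring
  have e2 : ∀ u, coeffZero x η u = (C (-‖x‖ ^ 2) * derivative (derivative η) +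
      (X ^ 2 * derivative (derivative η) + C (n - 1 : ℝ) * (X * derivative η))).eval
        (inner ℝ x (u : Euc n)) :=
    fun u => by simp [coeffZero]; ring
  simp only [e0, e1, e2] at h
  change weightedDual g η x + weightedDual f₀ _ x + weightedDual f₁ _ x + weightedDual f₂ _ x = 0
    at h
  rw [weightedDual_add h₀, weightedDual_C_mul, weightedDual_add h₁, weightedDual_C_mul,
    weightedDual_add h₂, weightedDual_C_mul] at h
  push_cast at h ⊢
  linear_combination -h

theorem exists_abs_eval_le (η : Polynomial ℝ) :
    ∃ C : ℝ, 0 ≤ C ∧ ∀ s : ℝ, |η.eval s| ≤ C * (1 + s ^ 2) ^ η.natDegree := by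
  refine ⟨∑ i ∈ Finset.range (η.natDegree + 1), |η.coeff i|, by positivity, fun s => ?_⟩
  rw [Polynomial.eval_eq_sum_range, Finset.sum_mul]
  refine (Finset.abs_sum_le_sum_abs _ _).trans (Finset.sum_le_sum fun i hi => ?_)
  rw [abs_mul, abs_pow]
  refine mul_le_mul_of_nonneg_left ((abs_pow_le_one_add_sq_pow s i).trans ?_) (abs_nonneg _)
  exact pow_le_pow_right₀ (by nlinarith [sq_nonneg s]) (by simpa [Nat.lt_succ_iff] using hi)

theorem TestFamily.dominated_weightedDual {f : ↥(SphereLizorkin n) → Sph n × ℝ → ℂ}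
    (hf : TestFamily f) (η : Polynomial ℝ) :
    Dominated fun ϱ (x : Euc n) => ‖weightedDual (f ϱ) η x‖ := by
  obtain ⟨C, hC0, hC⟩ := exists_abs_eval_le η
  obtain ⟨q, hq, hb⟩ := hf.dominated η.natDegree
  have h : Dominated fun (ϱ : ↥(SphereLizorkin n)) (_ : Euc n) => q ϱ :=
    ⟨q, hq, fun _ _ => le_rfl⟩
  refine ((h.const_mul hC0).const_mul (measureReal_nonneg (μ := surf n) (s := univ))).mono
    fun ϱ x => ?_
  refine (norm_integral_le_of_norm_le_const (C := C * q ϱ)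
    (Eventually.of_forall fun u => ?_)).trans (le_of_eq (mul_comm _ _))
  have h1 := hC (inner ℝ x (u : Euc n))
  have h2 := hb ϱ (u, inner ℝ x (u : Euc n))
  rw [norm_mul, Complex.norm_real, Real.norm_eq_abs]
  calc _ ≤ C * (1 + inner ℝ x (u : Euc n) ^ 2) ^ η.natDegree *
        ‖f ϱ (u, inner ℝ x (u : Euc n))‖ := mul_le_mul_of_nonneg_right h1 (norm_nonneg _)
    _ ≤ C * q ϱ := by rw [mul_assoc]; exact mul_le_mul_of_nonneg_left h2 hC0

/-- The dual Radon transforms of the iterated primitives decay rapidly. -/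
theorem dominated_pow_mul_weightedDual (N : ℕ) : ∀ (η : Polynomial ℝ) (m k : ℕ),
    Dominated fun (ϱ : ↥(SphereLizorkin n)) (x : Euc n) =>
      ‖x‖ ^ (2 * N) * ‖weightedDual (primJet m k ϱ) η x‖ := by
  induction N with
  | zero => exact fun η m k => by simpa using (testFamily_primJet m k).dominated_weightedDual η
  | succ N ih =>
    -- The inner induction is on a number `d` of derivatives that annihilates `η`. It handles the
    -- terms with `η'` and `η''`, which keep the power `2 * (N + 1)`; the four remaining terms have
    -- the power `2 * N` and fall under `ih`, which holds for arbitrary `η`, `m` and `k`.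
    have key : ∀ (d : ℕ) (η : Polynomial ℝ), Polynomial.derivative^[d] η = 0 → ∀ m k : ℕ,
        Dominated fun (ϱ : ↥(SphereLizorkin n)) (x : Euc n) =>
          ‖x‖ ^ (2 * (N + 1)) * ‖weightedDual (primJet m k ϱ) η x‖ := by
      intro d
      induction d with
      | zero =>
        intro η hη m k
        have : η = 0 := hη
        subst this
        simpa [weightedDual] using Dominated.zero
      | succ d ihd =>
        intro η hη m k
        have hη' : Polynomial.derivative^[d] (Polynomial.derivative η) = 0 := hη
        have hη'' : Polynomial.derivative^[d] (Polynomial.derivative (Polynomial.derivative η)) = 0 := by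
          rw [← Function.iterate_succ_apply, Function.iterate_succ_apply', hη', map_zero]
        refine ((((((ih η (m + 2) (k + 1)).add (ih (.X ^ 2 * η) m k)).add
          (ih (.C 2 * (.X ^ 2 * Polynomial.derivative η) + .C (n - 1 : ℝ) * (.X * η)) (m + 1) k)).add
          (ih (.X ^ 2 * Polynomial.derivative (Polynomial.derivative η) +
            .C (n - 1 : ℝ) * (.X * Polynomial.derivative η)) (m + 2) k)).add
          ((ihd _ hη' (m + 1) k).const_mul zero_le_two)).add (ihd _ hη'' (m + 2) k)).mono
          fun ϱ x => ?_
        have h := (hyperplaneIdentity_primJet m k ϱ).sq_mul_weightedDual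
          ((testFamily_primJet m k).rapid ϱ).cont ((testFamily_primJet (m + 1) k).rapid ϱ).cont
          ((testFamily_primJet (m + 2) k).rapid ϱ).cont η x
        have h2 : ‖x‖ ^ (2 * (N + 1)) * ‖weightedDual (primJet m k ϱ) η x‖ =
            ‖x‖ ^ (2 * N) * ‖((‖x‖ ^ 2 : ℝ) : ℂ) * weightedDual (primJet m k ϱ) η x‖ := by
          rw [norm_mul, Complex.norm_real, Real.norm_of_nonneg (by positivity)]; ring
        have h3 : ∀ c : ℂ, ‖x‖ ^ (2 * (N + 1)) * ‖c‖ =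
            ‖x‖ ^ (2 * N) * ‖((‖x‖ ^ 2 : ℝ) : ℂ) * c‖ := fun c => by
          rw [norm_mul, Complex.norm_real, Real.norm_of_nonneg (by positivity)]; ring
        rw [h2, h, h3, h3]
        have h4 : ∀ a b c d e f : ℂ, ‖a + b + c + d - 2 * e - f‖ ≤
            ‖a‖ + ‖b‖ + ‖c‖ + ‖d‖ + 2 * ‖e‖ + ‖f‖ := fun a b c d e f => by
          have := norm_sub_le (a + b + c + d - 2 * e) f
          have := norm_sub_le (a + b + c + d) (2 * e)
          have := norm_add_le (a + b + c) d
          have := norm_add_le (a + b) c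
          have := norm_add_le a b
          have : ‖2 * e‖ = 2 * ‖e‖ := by simp
          linarith
        refine (mul_le_mul_of_nonneg_left (h4 _ _ _ _ _ _) (by positivity)).trans (le_of_eq ?_)
        ring
    exact fun η m k => key (η.natDegree + 1) η
      (Polynomial.iterate_derivative_eq_zero (Nat.lt_succ_self _)) m k

/-! ### Differentiation under the integral sign -/

section smoothness

variable {n : ℕ} {F : Type} [NormedAddCommGroup F] [NormedSpace ℝ F]

/-- The dual Radon transform of `f` with an operator-valued weight `a`. -/
def dualOf (a : Sph n → ℂ →L[ℝ] F) (f : Sph n × ℝ → ℂ) (x : Euc n) : F :=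
  ∫ u : Sph n, a u (f (u, inner ℝ x (u : Euc n))) ∂(surf n)

/-- The weight of the derivative of a weighted dual Radon transform. -/
def derivWeight (a : Sph n → ℂ →L[ℝ] F) (u : Sph n) : ℂ →L[ℝ] Euc n →L[ℝ] F :=
  (ContinuousLinearMap.smulRightL ℝ (Euc n) F (innerSL ℝ (u : Euc n))).comp (a u)

theorem continuous_derivWeight {a : Sph n → ℂ →L[ℝ] F} (ha : Continuous a) :
    Continuous (derivWeight a) :=
  ((ContinuousLinearMap.continuous _).comp
    ((innerSL ℝ).continuous.comp continuous_subtype_val)).clm_comp ha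

/-- Since `‖u‖ = 1`, differentiating does not enlarge the weight, so one constant serves for all
orders. -/
theorem norm_derivWeight_le (a : Sph n → ℂ →L[ℝ] F) (u : Sph n) : ‖derivWeight a u‖ ≤ ‖a u‖ := by
  refine ContinuousLinearMap.opNorm_le_bound _ (norm_nonneg _) fun c => ?_
  change ‖(innerSL ℝ (u : Euc n)).smulRight (a u c)‖ ≤ _
  rw [ContinuousLinearMap.norm_smulRight_apply, innerSL_apply_norm]
  simpa using (a u).le_opNorm c

theorem continuous_dualOf_integrand {a : Sph n → ℂ →L[ℝ] F} (ha : Continuous a)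
    {f : Sph n × ℝ → ℂ} (hf : Continuous f) (x : Euc n) :
    Continuous fun u : Sph n => a u (f (u, inner ℝ x (u : Euc n))) :=
  ha.clm_apply (hf.comp (continuous_id.prodMk (continuous_inner_sphere x)))

theorem norm_dualOf_le {a : Sph n → ℂ →L[ℝ] F} {A : ℝ} (hA : ∀ u, ‖a u‖ ≤ A)
    {f : Sph n × ℝ → ℂ} {C : ℝ} (hC : ∀ z, ‖f z‖ ≤ C) (x : Euc n) :
    ‖dualOf a f x‖ ≤ A * C * (surf n).real univ :=
  norm_integral_le_of_norm_le_const (Eventually.of_forall fun u =>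
    ((a u).le_opNorm _).trans (mul_le_mul (hA u) (hC _) (norm_nonneg _)
      ((norm_nonneg _).trans (hA u))))

theorem hasFDerivAt_dualOf {a : Sph n → ℂ →L[ℝ] F} (ha : Continuous a) {f f' : Sph n × ℝ → ℂ}
    (hf : Continuous f) (hf' : Continuous f') (hd : ∀ u p, HasDerivAt (fun p => f (u, p)) (f' (u, p)) p)
    {C : ℝ} (hC : ∀ z, ‖f' z‖ ≤ C) (x : Euc n) :
    HasFDerivAt (dualOf a f) (dualOf (derivWeight a) f' x) x := by
  obtain ⟨A, hA⟩ := isCompact_univ.exists_bound_of_continuousOn ha.continuousOn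
  refine hasFDerivAt_integral_of_dominated_of_fderiv_le (s := univ)
    (F' := fun x u => derivWeight a u (f' (u, inner ℝ x (u : Euc n))))
    (bound := fun _ => A * C) Filter.univ_mem
    (Eventually.of_forall fun x => (continuous_dualOf_integrand ha hf x).aestronglyMeasurable)
    (integrable_sphere (continuous_dualOf_integrand ha hf x))
    (continuous_dualOf_integrand (continuous_derivWeight ha) hf' x).aestronglyMeasurable
    (Eventually.of_forall fun u y _ => ?_) (integrable_const _)
    (Eventually.of_forall fun u y _ => ?_)
  · exact ((derivWeight a u).le_opNorm _).trans (mul_le_mul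
      ((norm_derivWeight_le a u).trans (hA u trivial)) (hC _) (norm_nonneg _)
      ((norm_nonneg _).trans (hA u trivial)))
  · have h1 : HasFDerivAt (fun y : Euc n => inner ℝ y (u : Euc n)) (innerSL ℝ (u : Euc n)) y := by
      have e : (fun y : Euc n => inner ℝ y (u : Euc n)) = innerSL ℝ (u : Euc n) :=
        funext fun y => real_inner_comm _ _
      rw [e]
      exact (innerSL ℝ (u : Euc n)).hasFDerivAt
    have h2 := (a u).hasFDerivAt.comp y
      (HasFDerivAt.comp (g := fun p => f (u, p)) y (hd u (inner ℝ y (u : Euc n))).hasFDerivAt h1)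
    refine h2.congr_fderiv ?_
    ext v
    exact (map_smul (a u) (inner ℝ (u : Euc n) v) _)

/-- A sequence of bounded continuous functions, each one the derivative in the real variable of the
one before. -/
structure DerivChain (h : ℕ → Sph n × ℝ → ℂ) : Prop where
  cont : ∀ i, Continuous (h i)
  deriv : ∀ i u p, HasDerivAt (fun p => h i (u, p)) (h (i + 1) (u, p)) p
  bounded : ∀ i, ∃ C, ∀ z, ‖h i z‖ ≤ C

theorem DerivChain.tail {h : ℕ → Sph n × ℝ → ℂ} (hh : DerivChain h) :
    DerivChain fun i => h (i + 1) :=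
  ⟨fun i => hh.cont (i + 1), fun i => hh.deriv (i + 1), fun i => hh.bounded (i + 1)⟩

end smoothness

theorem DerivChain.hasFDerivAt {n : ℕ} {F : Type} [NormedAddCommGroup F] [NormedSpace ℝ F]
    {h : ℕ → Sph n × ℝ → ℂ} (hh : DerivChain h) {a : Sph n → ℂ →L[ℝ] F} (ha : Continuous a)
    (i : ℕ) (x : Euc n) :
    HasFDerivAt (dualOf a (h i)) (dualOf (derivWeight a) (h (i + 1)) x) x := by
  obtain ⟨C, hC⟩ := hh.bounded (i + 1)
  exact hasFDerivAt_dualOf ha (hh.cont i) (hh.cont (i + 1)) (hh.deriv i) hC x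

/-- The derivative is an integral of the same type, with the next function of the chain and a weight
valued in `Euc n →L[ℝ] F`. The induction therefore quantifies over all target spaces `F`. -/
theorem DerivChain.contDiff {n : ℕ} (m : ℕ) : ∀ {F : Type} [NormedAddCommGroup F] [NormedSpace ℝ F]
    {h : ℕ → Sph n × ℝ → ℂ} (_ : DerivChain h) {a : Sph n → ℂ →L[ℝ] F} (_ : Continuous a) {A : ℝ}
    (_ : ∀ u, ‖a u‖ ≤ A), ContDiff ℝ m (dualOf a (h 0)) ∧ ∀ {C : ℝ} (_ : ∀ z, ‖h m z‖ ≤ C) (x),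
      ‖iteratedFDeriv ℝ m (dualOf a (h 0)) x‖ ≤ A * C * (surf n).real univ := by
  induction m with
  | zero =>
    intro F _ _ h hh a ha A hA
    refine ⟨contDiff_zero.2 ?_, fun hC x => ?_⟩
    · exact continuous_iff_continuousAt.2 fun x => (hh.hasFDerivAt ha 0 x).continuousAt
    · rw [norm_iteratedFDeriv_zero]
      exact norm_dualOf_le hA hC x
  | succ m ih =>
    intro F _ _ h hh a ha A hA
    have hfd : fderiv ℝ (dualOf a (h 0)) = dualOf (derivWeight a) (h 1) :=
      funext fun x => (hh.hasFDerivAt ha 0 x).fderiv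
    obtain ⟨h1, h2⟩ := ih hh.tail (continuous_derivWeight ha)
      fun u => (norm_derivWeight_le a u).trans (hA u)
    refine ⟨?_, fun hC x => ?_⟩
    · have : ((m + 1 : ℕ) : WithTop ℕ∞) = (m : WithTop ℕ∞) + 1 := by push_cast; rfl
      rw [this, contDiff_succ_iff_fderiv]
      refine ⟨fun x => (hh.hasFDerivAt ha 0 x).differentiableAt, by simp, ?_⟩
      rw [hfd]
      exact h1
    · rw [← norm_iteratedFDeriv_fderiv, hfd]
      exact h2 hC x

/-! ### From bounded derivatives to rapidly decaying derivatives -/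

/-- A local Landau inequality. -/
theorem norm_fderiv_le_of_norm_le {E F : Type*} [NormedAddCommGroup E] [NormedSpace ℝ E]
    [NormedAddCommGroup F] [NormedSpace ℝ F] {g : E → F} (hg : Differentiable ℝ g) {x : E}
    {t M₀ M₂ : ℝ} (ht : 0 < t) (hM₂ : 0 ≤ M₂) (h₀ : ∀ y ∈ Metric.closedBall x t, ‖g y‖ ≤ M₀)
    (h₂ : ∀ y, ‖fderiv ℝ g y - fderiv ℝ g x‖ ≤ M₂ * ‖y - x‖) :
    ‖fderiv ℝ g x‖ ≤ 2 / t * M₀ + t * M₂ := by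
  have hM₀ : 0 ≤ M₀ := (norm_nonneg _).trans (h₀ x (Metric.mem_closedBall_self ht.le))
  refine ContinuousLinearMap.opNorm_le_bound _ (by positivity) fun v => ?_
  by_cases hv : v = 0
  · simp [hv]
  have hv0 : 0 < ‖v‖ := norm_pos_iff.2 hv
  -- The difference quotient is taken over a step of length exactly `t` in the direction `v`.
  set w : E := (t / ‖v‖) • v with hw
  have hwn : ‖w‖ = t := by
    rw [hw, norm_smul, Real.norm_of_nonneg (by positivity)]; field_simp
  have hmem : x + w ∈ Metric.closedBall x t := by simp [hwn]
  have h1 : ‖g (x + w) - g x - fderiv ℝ g x (x + w - x)‖ ≤ M₂ * t * ‖x + w - x‖ :=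
    (convex_closedBall x t).norm_image_sub_le_of_norm_fderiv_le' (fun y _ => hg y)
      (fun y hy => (h₂ y).trans (mul_le_mul_of_nonneg_left (mem_closedBall_iff_norm.1 hy) hM₂))
      (Metric.mem_closedBall_self ht.le) hmem
  rw [add_sub_cancel_left, hwn] at h1
  have h3 : ‖fderiv ℝ g x w‖ ≤ 2 * M₀ + M₂ * t * t := by
    have e : fderiv ℝ g x w = (g (x + w) - g x) - (g (x + w) - g x - fderiv ℝ g x w) := by abel
    rw [e]
    have := norm_sub_le (g (x + w) - g x) (g (x + w) - g x - fderiv ℝ g x w)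
    have := norm_sub_le (g (x + w)) (g x)
    have := h₀ _ hmem
    have := h₀ x (Metric.mem_closedBall_self ht.le)
    linarith
  rw [hw, map_smul, norm_smul, Real.norm_of_nonneg (by positivity)] at h3
  have h4 : ‖fderiv ℝ g x v‖ = ‖v‖ / t * (t / ‖v‖ * ‖fderiv ℝ g x v‖) := by field_simp
  rw [h4]
  calc ‖v‖ / t * (t / ‖v‖ * ‖fderiv ℝ g x v‖) ≤ ‖v‖ / t * (2 * M₀ + M₂ * t * t) := by gcongr
    _ = (2 / t * M₀ + t * M₂) * ‖v‖ := by field_simp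

/-- Even powers on the right match the powers of the norm that the decay estimate provides. -/
theorem one_add_pow_le (a : ℝ) (ha : 0 ≤ a) (N : ℕ) :
    (1 + a) ^ N ≤ 2 ^ N * (1 + a ^ (2 * N)) := by
  rcases le_total a 1 with h | h
  · calc (1 + a) ^ N ≤ 2 ^ N := pow_le_pow_left₀ (by positivity) (by linarith) N
      _ ≤ 2 ^ N * (1 + a ^ (2 * N)) := le_mul_of_one_le_right (by positivity)
          (by have : 0 ≤ a ^ (2 * N) := by positivity
              linarith)
  · calc (1 + a) ^ N ≤ (2 * a) ^ N := pow_le_pow_left₀ (by positivity) (by linarith) N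
      _ = 2 ^ N * a ^ N := mul_pow _ _ _
      _ ≤ 2 ^ N * (1 + a ^ (2 * N)) := by
          have : a ^ N ≤ a ^ (2 * N) := pow_le_pow_right₀ h (by omega)
          gcongr
          linarith

/-- A smooth function with bounded derivatives which decays rapidly has derivatives which decay
rapidly, with bounds that are uniform in a family. -/
theorem dominated_iteratedFDeriv {V : Type*} [AddCommGroup V] [Module ℂ V] [TopologicalSpace V]
    {E : Type*} [NormedAddCommGroup E] [NormedSpace ℝ E] {ψ : V → E → ℂ}
    (hψ : ∀ v, ContDiff ℝ ∞ (ψ v))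
    (h₀ : ∀ N : ℕ, Dominated fun v x => ‖x‖ ^ (2 * N) * ‖ψ v x‖)
    (hb : ∀ m : ℕ, Dominated fun v x => ‖iteratedFDeriv ℝ m (ψ v) x‖) (m : ℕ) :
    ∀ N : ℕ, Dominated fun v x => (1 + ‖x‖) ^ N * ‖iteratedFDeriv ℝ m (ψ v) x‖ := by
  induction m with
  | zero =>
    intro N
    refine (((h₀ 0).add (h₀ N)).const_mul (c := 2 ^ N) (by positivity)).mono fun v x => ?_
    rw [norm_iteratedFDeriv_zero]
    calc (1 + ‖x‖) ^ N * ‖ψ v x‖ ≤ 2 ^ N * (1 + ‖x‖ ^ (2 * N)) * ‖ψ v x‖ :=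
          mul_le_mul_of_nonneg_right (one_add_pow_le _ (norm_nonneg x) N) (norm_nonneg _)
      _ = _ := by ring
  | succ m ih =>
    intro N
    -- Each order costs half of the decay: weight `s²` at order `m` and boundedness at order `m + 2`
    -- give weight `s` at order `m + 1`.
    obtain ⟨q₁, hq₁, hb₁⟩ := ih (2 * N)
    obtain ⟨q₂, hq₂, hb₂⟩ := hb (m + 2)
    have d₁ : Dominated fun (v : V) (_ : E) => q₁ v := ⟨q₁, hq₁, fun _ _ => le_rfl⟩
    have d₂ : Dominated fun (v : V) (_ : E) => q₂ v := ⟨q₂, hq₂, fun _ _ => le_rfl⟩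
    refine ((d₁.const_mul (c := 4 * 2 ^ (2 * N)) (by positivity)).add
      (d₂.const_mul (c := 1 / 2) (by norm_num))).mono fun v x => ?_
    set s : ℝ := (1 + ‖x‖) ^ N with hs
    have hs1 : 1 ≤ s := one_le_pow₀ (by linarith [norm_nonneg x])
    have hs0 : 0 < s := by linarith
    have hdiff : ∀ k : ℕ, Differentiable ℝ (iteratedFDeriv ℝ k (ψ v)) := fun k =>
      (hψ v).differentiable_iteratedFDeriv (WithTop.coe_lt_coe.2 (WithTop.coe_lt_top k))
    -- The radius `1 / (2 * s)` balances the two terms of the Landau inequality, both then being of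
    -- size `1 / s`. It is at most `1 / 2`, so `1 + ‖x‖ ≤ 2 * (1 + ‖y‖)` on the ball.
    have hball : ∀ y ∈ Metric.closedBall x (1 / (2 * s)),
        ‖iteratedFDeriv ℝ m (ψ v) y‖ ≤ 2 ^ (2 * N) * q₁ v / s ^ 2 := fun y hy => by
      have h1 : ‖y - x‖ ≤ 1 / (2 * s) := mem_closedBall_iff_norm.1 hy
      have h2 : 1 / (2 * s) ≤ 1 / 2 := by
        apply one_div_le_one_div_of_le <;> linarith
      have h3 : ‖x‖ ≤ ‖y‖ + ‖y - x‖ := by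
        have := norm_sub_le y (y - x)
        simpa using this
      have h4 : (1 + ‖x‖) ^ (2 * N) ≤ (2 * (1 + ‖y‖)) ^ (2 * N) :=
        pow_le_pow_left₀ (by positivity) (by linarith [norm_nonneg y]) _
      have h5 : s ^ 2 = (1 + ‖x‖) ^ (2 * N) := by rw [hs, ← pow_mul, mul_comm]
      rw [le_div_iff₀ (by positivity), h5]
      calc ‖iteratedFDeriv ℝ m (ψ v) y‖ * (1 + ‖x‖) ^ (2 * N)
          ≤ ‖iteratedFDeriv ℝ m (ψ v) y‖ * (2 * (1 + ‖y‖)) ^ (2 * N) := by gcongr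
        _ = 2 ^ (2 * N) * ((1 + ‖y‖) ^ (2 * N) * ‖iteratedFDeriv ℝ m (ψ v) y‖) := by
            rw [mul_pow]; ring
        _ ≤ 2 ^ (2 * N) * q₁ v := mul_le_mul_of_nonneg_left (hb₁ v y) (by positivity)
    have hlip : ∀ y, ‖fderiv ℝ (iteratedFDeriv ℝ m (ψ v)) y -
        fderiv ℝ (iteratedFDeriv ℝ m (ψ v)) x‖ ≤ q₂ v * ‖y - x‖ := fun y => by
      rw [fderiv_iteratedFDeriv]
      simp only [Function.comp_apply]
      rw [← LinearIsometryEquiv.map_sub, LinearIsometryEquiv.norm_map]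
      exact convex_univ.norm_image_sub_le_of_norm_fderiv_le (fun z _ => hdiff (m + 1) z)
        (fun z _ => by rw [norm_fderiv_iteratedFDeriv]; exact hb₂ v z) trivial trivial
    have key := norm_fderiv_le_of_norm_le (hdiff m) (by positivity : 0 < 1 / (2 * s))
      (apply_nonneg q₂ v) hball hlip
    rw [norm_fderiv_iteratedFDeriv] at key
    calc s * ‖iteratedFDeriv ℝ (m + 1) (ψ v) x‖
        ≤ s * (2 / (1 / (2 * s)) * (2 ^ (2 * N) * q₁ v / s ^ 2) + 1 / (2 * s) * q₂ v) := by gcongr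
      _ = _ := by field_simp; ring

/-! ### The dual Radon transforms of primitives as Schwartz functions -/

section chain

variable {n : ℕ} [Fact (2 ≤ n)]

/-- The `i`-th derivative in the real variable of the `m`-fold primitive of `ϱ`. -/
def primChain : ℕ → ℕ → ↥(SphereLizorkin n) → Sph n × ℝ → ℂ
  | 0, i => jet 0 i
  | m + 1, 0 => primJet (m + 1) 0
  | m + 1, i + 1 => primChain m i

theorem primChain_zero (m : ℕ) : primChain (n := n) m 0 = primJet m 0 := by
  cases m <;> rfl

theorem testFamily_primChain : ∀ m i : ℕ, TestFamily (primChain (n := n) m i)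
  | 0, i => testFamily_jet 0 i
  | m + 1, 0 => testFamily_primJet (m + 1) 0
  | m + 1, i + 1 => testFamily_primChain m i

theorem hasDerivAt_primJet (m : ℕ) (ϱ : ↥(SphereLizorkin n)) (u : Sph n) (p : ℝ) :
    HasDerivAt (fun p => primJet (m + 1) 0 ϱ (u, p)) (primJet m 0 ϱ (u, p)) p := by
  simp only [primJet, Function.iterate_succ_apply']
  exact ((testFamily_primJet m 0).rapid ϱ).hasDerivAt_primitive u p

theorem hasDerivAt_primChain (ϱ : ↥(SphereLizorkin n)) (u : Sph n) (p : ℝ) : ∀ m i : ℕ,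
    HasDerivAt (fun p => primChain m i ϱ (u, p)) (primChain m (i + 1) ϱ (u, p)) p
  | 0, i => hasDerivAt_jet 0 i ϱ u p
  | m + 1, 0 => by
    have h := hasDerivAt_primJet m ϱ u p
    rwa [← primChain_zero, ← primChain_zero] at h
  | m + 1, i + 1 => hasDerivAt_primChain ϱ u p m i

theorem TestFamily.dominated_norm {f : ↥(SphereLizorkin n) → Sph n × ℝ → ℂ} (hf : TestFamily f) :
    Dominated fun ϱ z => ‖f ϱ z‖ := by
  simpa using hf.dominated 0

theorem derivChain_primChain (m : ℕ) (ϱ : ↥(SphereLizorkin n)) :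
    DerivChain fun i => primChain m i ϱ where
  cont i := ((testFamily_primChain m i).rapid ϱ).cont
  deriv i u p := hasDerivAt_primChain ϱ u p m i
  bounded i :=
    let ⟨q, _, hb⟩ := (testFamily_primChain m i).dominated_norm
    ⟨q ϱ, hb ϱ⟩

/-- The dual Radon transform of the `m`-fold primitive of `ϱ`. -/
def dualPrim (m : ℕ) (ϱ : ↥(SphereLizorkin n)) : Euc n → ℂ := dualRadon (primJet m 0 ϱ)

theorem dualPrim_eq_dualOf (m : ℕ) (ϱ : ↥(SphereLizorkin n)) :
    dualPrim m ϱ = dualOf (fun _ => ContinuousLinearMap.id ℝ ℂ) (primChain m 0 ϱ) := by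
  rw [primChain_zero]
  rfl

theorem dualPrim_eq_weightedDual (m : ℕ) (ϱ : ↥(SphereLizorkin n)) :
    dualPrim m ϱ = weightedDual (primJet m 0 ϱ) 1 := by
  funext x
  simp [dualPrim, dualRadon, weightedDual]

theorem contDiff_dualPrim (m : ℕ) (ϱ : ↥(SphereLizorkin n)) : ContDiff ℝ ∞ (dualPrim m ϱ) := by
  refine contDiff_infty.2 fun k => ?_
  rw [dualPrim_eq_dualOf]
  exact ((derivChain_primChain m ϱ).contDiff k continuous_const fun _ => le_rfl).1

theorem dominated_iteratedFDeriv_dualPrim (m k N : ℕ) :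
    Dominated fun (ϱ : ↥(SphereLizorkin n)) (x : Euc n) =>
      (1 + ‖x‖) ^ N * ‖iteratedFDeriv ℝ k (dualPrim m ϱ) x‖ := by
  refine dominated_iteratedFDeriv (contDiff_dualPrim m) (fun N => ?_) (fun j => ?_) k N
  · simpa only [dualPrim_eq_weightedDual] using dominated_pow_mul_weightedDual N 1 m 0
  · obtain ⟨q, hq, hb⟩ := (testFamily_primChain (n := n) m j).dominated_norm
    have h : Dominated fun (ϱ : ↥(SphereLizorkin n)) (_ : Euc n) => q ϱ :=
      ⟨q, hq, fun _ _ => le_rfl⟩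
    refine (h.const_mul (c := ‖ContinuousLinearMap.id ℝ ℂ‖ * (surf n).real univ)
      (by positivity)).mono fun ϱ x => ?_
    rw [dualPrim_eq_dualOf]
    refine (((derivChain_primChain m ϱ).contDiff j continuous_const fun _ => le_rfl).2
      (hb ϱ) x).trans (le_of_eq (by ring))

theorem dominated_pow_mul_iteratedFDeriv_dualPrim (m N k : ℕ) :
    Dominated fun (ϱ : ↥(SphereLizorkin n)) (x : Euc n) =>
      ‖x‖ ^ N * ‖iteratedFDeriv ℝ k (dualPrim m ϱ) x‖ :=
  (dominated_iteratedFDeriv_dualPrim m k N).mono fun _ x => by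
    gcongr
    linarith

/-- The dual Radon transform of the `m`-fold primitive of `ϱ`, as a Schwartz function. -/
def dualSchwartz (m : ℕ) (ϱ : ↥(SphereLizorkin n)) : 𝓢(Euc n, ℂ) where
  toFun := dualPrim m ϱ
  smooth' := contDiff_dualPrim m ϱ
  decay' N k :=
    let ⟨q, _, hb⟩ := dominated_pow_mul_iteratedFDeriv_dualPrim (n := n) m N k
    ⟨q ϱ, hb ϱ⟩

theorem dualSchwartz_zero_apply (ϱ : ↥(SphereLizorkin n)) (x : Euc n) :
    dualSchwartz 0 ϱ x = dualRadon (fun z => ϱ.1 z) x := rfl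

end chain

/-! ### The Laplacian of a dual Radon transform -/

theorem DerivChain.fderiv_dualOf_apply {n : ℕ} {h : ℕ → Sph n × ℝ → ℂ} (hh : DerivChain h)
    {a : Sph n → ℂ →L[ℝ] ℂ} (ha : Continuous a) (i : ℕ) (x v : Euc n) :
    fderiv ℝ (dualOf a (h i)) x v =
      dualOf (fun u => inner ℝ (u : Euc n) v • a u) (h (i + 1)) x := by
  rw [(hh.hasFDerivAt ha i x).fderiv]
  exact (ContinuousLinearMap.integral_apply (integrable_sphere
    (continuous_dualOf_integrand (continuous_derivWeight ha) (hh.cont (i + 1)) x)) v)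

/-- The directional derivative of a Schwartz function. -/
def dirDeriv {n : ℕ} (v : Euc n) (φ : 𝓢(Euc n, ℂ)) : 𝓢(Euc n, ℂ) := LineDeriv.lineDerivOp v φ

theorem dirDeriv_apply {n : ℕ} (v : Euc n) (φ : 𝓢(Euc n, ℂ)) (x : Euc n) :
    dirDeriv v φ x = fderiv ℝ φ x v := rfl

theorem sum_sq_coord {n : ℕ} (u : Sph n) : ∑ i, (u : Euc n) i ^ 2 = 1 := by
  have h : ‖(u : Euc n)‖ = 1 := by simp
  rw [EuclideanSpace.norm_eq, Real.sqrt_eq_one] at h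
  simpa using h

section laplacian

variable {n : ℕ} [Fact (2 ≤ n)]

/-- Each derivative along `v` brings out a factor `⟪u, v⟫` and undoes one primitive. -/
theorem dirDeriv_dirDeriv_dualSchwartz (m : ℕ) (ϱ : ↥(SphereLizorkin n)) (v x : Euc n) :
    dirDeriv v (dirDeriv v (dualSchwartz (m + 2) ϱ)) x =
      ∫ u : Sph n, ((inner ℝ (u : Euc n) v ^ 2 : ℝ) : ℂ) *
        primJet m 0 ϱ (u, inner ℝ x (u : Euc n)) ∂(surf n) := by
  have hc := derivChain_primChain (m + 2) ϱ
  have hcont : Continuous fun u : Sph n => inner ℝ (u : Euc n) v • ContinuousLinearMap.id ℝ ℂ := by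
    fun_prop
  have h1 : ⇑(dirDeriv v (dualSchwartz (m + 2) ϱ)) = dualOf
      (fun u => inner ℝ (u : Euc n) v • ContinuousLinearMap.id ℝ ℂ) (primChain (m + 2) 1 ϱ) := by
    funext y
    rw [dirDeriv_apply, ← hc.fderiv_dualOf_apply continuous_const 0 y v,
      ← dualPrim_eq_dualOf]
    rfl
  rw [dirDeriv_apply, h1, hc.fderiv_dualOf_apply hcont 1 x v]
  refine integral_congr_ae (Eventually.of_forall fun u => ?_)
  change inner ℝ (u : Euc n) v • inner ℝ (u : Euc n) v • primChain m 0 ϱ _ = _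
  rw [primChain_zero, smul_smul, ← sq, Complex.real_smul]

/-- The squared coordinates of `u` sum to `1`, so the Euclidean Laplacian does nothing but undo two
primitives. -/
theorem sum_dirDeriv_dirDeriv_dualSchwartz (m : ℕ) (ϱ : ↥(SphereLizorkin n)) (x : Euc n) :
    ∑ i, dirDeriv (EuclideanSpace.single i 1) (dirDeriv (EuclideanSpace.single i 1)
      (dualSchwartz (m + 2) ϱ)) x = dualSchwartz m ϱ x := by
  have hcont := ((testFamily_primJet m 0).rapid ϱ).cont
  simp only [dirDeriv_dirDeriv_dualSchwartz]
  rw [← integral_finsetSum]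
  · refine integral_congr_ae (Eventually.of_forall fun u => ?_)
    simp only [EuclideanSpace.inner_single_right, ← Finset.sum_mul, ← Complex.ofReal_sum]
    simp [sum_sq_coord]
  · intro i _
    refine integrable_sphere ((Complex.continuous_ofReal.comp (by fun_prop)).mul
      (hcont.comp (continuous_id.prodMk (continuous_inner_sphere x))))

end laplacian

/-! ### Moments -/

section moments

variable {n : ℕ}

open Function

/-- The truncated exponent `m i - 1` is harmless when `m i = 0`, because of the factor `m i`. -/
theorem hasLineDerivAt_monomial (m : Fin n → ℕ) (i : Fin n) (x : Euc n) :
    HasLineDerivAt ℝ (monomial m) (m i * monomial (update m i (m i - 1)) x) x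
      (EuclideanSpace.single i 1) := by
  have h1 : ∀ (k : Fin n → ℕ) (y : Euc n),
      monomial k y = y i ^ k i * ∏ j ∈ Finset.univ.erase i, y j ^ k j := fun k y =>
    (Finset.mul_prod_erase _ _ (Finset.mem_univ i)).symm
  have h2 : ∀ t : ℝ, monomial m (x + t • EuclideanSpace.single i 1) =
      (x i + t) ^ m i * ∏ j ∈ Finset.univ.erase i, x j ^ m j := fun t => by
    rw [h1]
    congr 1
    · simp
    · exact Finset.prod_congr rfl fun j hj => by simp [Finset.ne_of_mem_erase hj]
  have h3 : monomial (update m i (m i - 1)) x =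
      x i ^ (m i - 1) * ∏ j ∈ Finset.univ.erase i, x j ^ m j := by
    rw [h1]
    congr 1
    · simp
    · exact Finset.prod_congr rfl fun j hj => by simp [Finset.ne_of_mem_erase hj]
  unfold HasLineDerivAt
  simp only [h2, h3]
  have h4 := ((((hasDerivAt_id (0 : ℝ)).const_add (x i)).fun_pow (m i)).mul_const
    (∏ j ∈ Finset.univ.erase i, x j ^ m j))
  simpa [mul_assoc] using h4

theorem integral_monomial_smul_dirDeriv (m : Fin n → ℕ) (i : Fin n) (φ : 𝓢(Euc n, ℂ)) :
    ∫ x, monomial m x • dirDeriv (EuclideanSpace.single i 1) φ x =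
      -(m i * ∫ x, monomial (update m i (m i - 1)) x • φ x) := by
  have hint : Integrable fun x : Euc n =>
      (m i * monomial (update m i (m i - 1)) x) • φ x := by
    simp only [mul_smul]
    exact (integrable_monomial_smul (update m i (m i - 1)) φ).smul (m i : ℝ)
  have h := integral_bilinear_hasLineDerivAt_right_eq_neg_left_of_integrable
    (B := ContinuousLinearMap.lsmul ℝ ℝ) (v := EuclideanSpace.single i (1 : ℝ)) (μ := volume)
    (f := monomial m) (f' := fun x => m i * monomial (update m i (m i - 1)) x) (g := φ)
    (g' := dirDeriv (EuclideanSpace.single i 1) φ) hint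
    (integrable_monomial_smul m _) (integrable_monomial_smul m φ)
    (fun x _ => hasLineDerivAt_monomial m i x) (fun x _ => by
      rw [dirDeriv_apply]
      exact (φ.hasFDerivAt x).hasLineDerivAt _)
  simp only [ContinuousLinearMap.lsmul_apply] at h
  rw [h]
  simp only [mul_smul, Complex.real_smul, Complex.ofReal_natCast, integral_const_mul]

theorem sum_update_sub_one_lt {m : Fin n → ℕ} {i : Fin n} (hi : m i ≠ 0) :
    ∑ j, update m i (m i - 1) j < ∑ j, m j := by
  refine Finset.sum_lt_sum (fun j _ => ?_) ⟨i, Finset.mem_univ i, by simp; omega⟩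
  by_cases h : j = i
  · subst h; simp
  · simp [h]

theorem sum_update_sub_one_le (m : Fin n → ℕ) (i : Fin n) :
    ∑ j, update m i (m i - 1) j ≤ ∑ j, m j := by
  refine Finset.sum_le_sum (fun j _ => ?_)
  by_cases h : j = i
  · subst h; simp
  · simp [h]

variable [Fact (2 ≤ n)]

/-- The `k`-fold primitive gives the Laplacian of the transform of the `(k + 2)`-fold one, and two
integrations by parts move it onto the monomial. As the number of primitives grows while the degree
drops, the induction runs over all `k` together. -/
theorem integral_monomial_smul_dualSchwartz (ϱ : ↥(SphereLizorkin n)) (d : ℕ) :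
    ∀ m : Fin n → ℕ, ∑ j, m j = d → ∀ k, ∫ x, monomial m x • dualSchwartz k ϱ x = 0 := by
  induction d using Nat.strong_induction_on with
  | _ d ih =>
    intro m hm k
    simp only [← sum_dirDeriv_dirDeriv_dualSchwartz k ϱ, Finset.smul_sum]
    rw [integral_finsetSum _ fun i _ => integrable_monomial_smul m _]
    refine Finset.sum_eq_zero fun i _ => ?_
    rw [integral_monomial_smul_dirDeriv, integral_monomial_smul_dirDeriv]
    -- If `m i = 0`, the outer integration by parts already gives `0`; otherwise the degree strictly
    -- decreases, even if the second exponent is truncated.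
    by_cases hi : m i = 0
    · simp [hi]
    · have hlt := (sum_update_sub_one_le (update m i (m i - 1)) i).trans_lt
        (sum_update_sub_one_lt hi)
      rw [ih _ (hm ▸ hlt) _ rfl (k + 2)]
      simp

theorem dualSchwartz_mem_lizorkin (k : ℕ) (ϱ : ↥(SphereLizorkin n)) :
    dualSchwartz k ϱ ∈ Lizorkin n :=
  fun m => integral_monomial_smul_dualSchwartz ϱ _ m rfl k

end moments

/-! ### The dual Radon transform and the Radon transform -/

section radon

variable (n : ℕ) [Fact (2 ≤ n)]

/-- The dual Radon transform `𝓢₀(𝕊ⁿ⁻¹ × ℝ) → 𝓢(ℝⁿ)`. -/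
def dualRadonLM : ↥(SphereLizorkin n) →ₗ[ℂ] 𝓢(Euc n, ℂ) where
  toFun := dualSchwartz 0
  map_add' ϱ σ := by
    ext x
    have hi : ∀ τ : ↥(SphereLizorkin n), Integrable (fun u : Sph n =>
        τ.1 (u, inner ℝ x (u : Euc n))) (surf n) := fun τ =>
      integrable_sphere ((contMDiff_jet 0 0 τ).continuous.comp
        (continuous_id.prodMk (continuous_inner_sphere x)))
    rw [add_apply]
    simp only [dualSchwartz_zero_apply]
    exact integral_add (hi ϱ) (hi σ)
  map_smul' c ϱ := by
    ext x
    rw [smul_apply]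
    simp only [dualSchwartz_zero_apply]
    exact integral_const_mul c _

theorem continuous_dualRadonLM : Continuous (dualRadonLM n) := by
  refine WithSeminorms.continuous_of_continuous_comp (schwartz_withSeminorms ℂ (Euc n) ℂ) _ fun i => ?_
  obtain ⟨q, hq, hb⟩ := dominated_pow_mul_iteratedFDeriv_dualPrim (n := n) 0 i.1 i.2
  exact Seminorm.continuous_of_le hq fun ϱ =>
    SchwartzMap.seminorm_le_bound ℂ i.1 i.2 _ (apply_nonneg q ϱ) (hb ϱ)

/-- The dual Radon transform `𝓢₀(𝕊ⁿ⁻¹ × ℝ) → 𝓢₀(ℝⁿ)`. -/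
def dualRadonCLM : ↥(SphereLizorkin n) →L[ℂ] ↥(Lizorkin n) where
  toLinearMap := (dualRadonLM n).codRestrict (Lizorkin n) (dualSchwartz_mem_lizorkin 0)
  cont := (continuous_dualRadonLM n).subtype_mk _

end radon

end LizorkinRadon

end

theorem corollary6p3 (n : ℕ) [Fact (2 ≤ n)] :
    ∃ Rstar : ↥(LizorkinRadon.SphereLizorkin n) →L[ℂ] ↥(LizorkinRadon.Lizorkin n),
      (∀ (ϱ : ↥(LizorkinRadon.SphereLizorkin n)) (x : LizorkinRadon.Euc n),
        (Rstar ϱ : SchwartzMap (LizorkinRadon.Euc n) ℂ) x =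
          LizorkinRadon.dualRadon (fun z => ϱ.1 z) x) ∧
      ∃ R : LizorkinRadon.LizorkinDistribution n →ₗ[ℂ] LizorkinRadon.SphereLizorkinDistribution n,
        (∀ (f : LizorkinRadon.LizorkinDistribution n) (ϱ : ↥(LizorkinRadon.SphereLizorkin n)),
          R f ϱ = f (Rstar ϱ)) ∧
        Continuous R :=
  ⟨LizorkinRadon.dualRadonCLM n, LizorkinRadon.dualSchwartz_zero_apply,
    -- Precomposition is continuous for uniform convergence on bounded sets because a continuous
    -- linear map sends bounded sets to bounded sets.
    (ContinuousLinearMap.precomp ℂ (LizorkinRadon.dualRadonCLM n)).toLinearMap, fun _ _ => rfl,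
    (ContinuousLinearMap.precomp ℂ (LizorkinRadon.dualRadonCLM n)).continuous⟩
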